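/- Let $|\psi\rangle^{RAB}\in\mathbb{C}^2\otimes\mathbb{C}^2\otimes\mathbb{C}^2$ be a three-qubit unit vector whose reduced state on $R$ is $\psi^R=\mathbb{1}/2$, and let $\lambda_0^B$ be the largest eigenvalue of its reduced state $\psi^B$. For an integer $K\ge 1$ let $|\Phi_K^+\rangle=K^{-1/2}\sum_{l=0}^{K-1}|l\rangle\otimes|l\rangle$ be the maximally entangled state of Schmidt rank $K$ on systems $\overline{A},\overline{B}$. Say that non-catalytic exact state merging of $|\psi\rangle^{RAB}$ is achievable with $\Phi_K^+$, that is, at entanglement cost $\log_2 K$, if there is an LOCC map $\mathcal{M}$ between the parties $A$ (holding $A,\overline{A}$) and $B$ (holding $B,\overline{B}$), with finitely or infinitely many rounds, such that $$(\mathrm{id}^R\otimes\mathcal{M})\bigl(\psi^{RAB}\otimes{\Phi_K^+}^{\overline{A}\,\overline{B}}\bigr)=\psi^{RB'B},$$ where in the output the party $B$ holds both $B'$ (a copy of the system $A$) and $B$. Here an LOCC map is one obtained by each party locally encoding its input into a finite-dimensional working system, the parties then performing on the working systems a finite sequence of one-way local instruments (each acting party and instrument may depend on all previous outcomes kept), or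 a limit of such sequences each of which extends its predecessor by one round, and each party finally producing its output by a local channel. Then: 1. For every integer $K\ge 1$, non-catalytic exact state merging of $|\psi\rangle^{RAB}$ is achievable with $\Phi_K^+$ if and only if $\log_2 K\ge\log_2\lceil 2\lambda_0^B\rceil$. 2. Equivalently, non-catalytic exact state merging of $|\psi\rangle^{RAB}$ is achievable at entanglement cost $\log_2 K=0$ if and only if $\psi^B=\mathbb{1}/2$; and if $\psi^B\ne\mathbb{1}/2$, then the least entanglement cost at which it is achievable is $\log_2 K=1$. -/

import Mathlib

open Filter Topology Matrix
open scoped Kronecker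

noncomputable section

/-! States and operators of finite-dimensional systems: a system with computational basis `n` has
Hilbert space `ℂ^n`, composite systems are indexed by products of index types. -/

/-- Linear maps `B(ℂ^n) → B(ℂ^m)`. -/
abbrev SuperOp (n m : Type*) := Matrix n n ℂ →ₗ[ℂ] Matrix m m ℂ

/-- The operator `|v⟩⟨v|`. -/
def pureState {n : Type*} (v : n → ℂ) : Matrix n n ℂ := Matrix.vecMulVec v (star v)

/-- Partial trace over the first tensor factor. -/
def traceFst {m n : Type*} [Fintype m] (ρ : Matrix (m × n) (m × n) ℂ) : Matrix n n ℂ :=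
  Matrix.of fun j j' => ∑ i, ρ (i, j) (i, j')

/-- Partial trace over the second tensor factor. -/
def traceSnd {m n : Type*} [Fintype n] (ρ : Matrix (m × n) (m × n) ℂ) : Matrix m m ℂ :=
  Matrix.of fun i i' => ∑ j, ρ (i, j) (i', j)

/-- The reduced state `ψ^R` of a vector of `R ⊗ (A ⊗ B)`. -/
def reducedR {r a b : Type*} [Fintype a] [Fintype b] (ψ : EuclideanSpace ℂ (r × a × b)) :
    Matrix r r ℂ :=
  traceSnd (pureState fun x => ψ x)

/-- The reduced state `ψ^B` of a vector of `R ⊗ (A ⊗ B)`. -/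
def reducedB {r a b : Type*} [Fintype r] [Fintype a] (ψ : EuclideanSpace ℂ (r × a × b)) :
    Matrix b b ℂ :=
  traceFst (traceFst (pureState fun x => ψ x))

/-- `lam` is the largest eigenvalue of the (Hermitian) matrix `M`. -/
def IsLargestEigenvalue {n : Type*} [Fintype n] [DecidableEq n] (M : Matrix n n ℂ) (lam : ℝ) :
    Prop :=
  IsGreatest {μ : ℝ | Module.End.HasEigenvalue (Matrix.toLin' M) (μ : ℂ)} lam

/-- The map `ρ ↦ ∑ i, V i * ρ * (V i)ᴴ`. -/
def krausMap {n m : Type*} [Fintype n] {k : ℕ} (V : Fin k → Matrix m n ℂ) : SuperOp n m where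
  toFun ρ := ∑ i, V i * ρ * (V i)ᴴ
  map_add' ρ σ := by simp [Matrix.mul_add, Matrix.add_mul, Finset.sum_add_distrib]
  map_smul' c ρ := by simp [Finset.smul_sum]

/-- Completely positive maps, through Kraus representations. -/
def IsCompletelyPositive {n m : Type*} [Fintype n] (Φ : SuperOp n m) : Prop :=
  ∃ (k : ℕ) (V : Fin k → Matrix m n ℂ), Φ = krausMap V

/-- Trace-preserving maps. -/
def IsTracePreserving {n m : Type*} [Fintype n] [Fintype m] (Φ : SuperOp n m) : Prop :=
  ∀ ρ, (Φ ρ).trace = ρ.trace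

/-- Completely positive trace-preserving (CPTP) maps. -/
def IsChannel {n m : Type*} [Fintype n] [Fintype m] (Φ : SuperOp n m) : Prop :=
  IsCompletelyPositive Φ ∧ IsTracePreserving Φ

/-- Quantum instruments: families of completely positive maps (one for each outcome) whose sum is
trace preserving. -/
def IsInstrument {ι n m : Type*} [Fintype ι] [Fintype n] [Fintype m] (E : ι → SuperOp n m) :
    Prop :=
  (∀ j, IsCompletelyPositive (E j)) ∧ IsTracePreserving (∑ j, E j)

/-- The tensor product `Φ ⊗ Ψ`, that is, the linear map with
`(Φ ⊗ Ψ) (ρ ⊗ σ) = Φ ρ ⊗ Ψ σ`, written out on matrix units. -/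
def tensorMap {a b a' b' : Type*} [Fintype a] [Fintype b] [DecidableEq a] [DecidableEq b]
    (Φ : SuperOp a a') (Ψ : SuperOp b b') : SuperOp (a × b) (a' × b') where
  toFun ρ := ∑ x : a × b, ∑ y : a × b,
    ρ x y • (Φ (Matrix.single x.1 y.1 1) ⊗ₖ Ψ (Matrix.single x.2 y.2 1))
  map_add' ρ σ := by simp [add_smul, Finset.sum_add_distrib]
  map_smul' c ρ := by simp [mul_smul, Finset.smul_sum]

/-! LOCC between two parties. The first factor of `a × b` belongs to `A`, the second to `B`. -/

section LOCC

variable {a b : Type*} [Fintype a] [Fintype b] [DecidableEq a] [DecidableEq b]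

/-- One-way local instruments: one party performs an instrument `E` and announces the outcome `j`,
then the other party performs a channel `T j`. -/
def IsOneWayLocal {ι : Type*} [Fintype ι] (F : ι → SuperOp (a × b) (a × b)) : Prop :=
  (∃ (E : ι → SuperOp a a) (T : ι → SuperOp b b),
      IsInstrument E ∧ (∀ j, IsChannel (T j)) ∧ ∀ j, F j = tensorMap (E j) (T j)) ∨
  (∃ (T : ι → SuperOp a a) (E : ι → SuperOp b b),
      IsInstrument E ∧ (∀ j, IsChannel (T j)) ∧ ∀ j, F j = tensorMap (T j) (E j))

/-- `F'` arises from `F` by merging outcomes (forgetting part of the classical information). -/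
def IsCoarseGraining {ι n : Type*} [Fintype ι] {k : ℕ} (F' : Fin k → SuperOp n n)
    (F : ι → SuperOp n n) : Prop :=
  ∃ f : ι → Fin k, ∀ i, F' i = ∑ j with f j = i, F j

/-- `F'` is LOCC linked to `F`: it is a coarse-graining of the instrument which first performs `F`
and then, given the outcome `j`, a one-way local instrument `G j`. The party that measures in `G j`
may depend on `j`. -/
def IsLOCCLinked {k k' : ℕ} (F' : Fin k' → SuperOp (a × b) (a × b))
    (F : Fin k → SuperOp (a × b) (a × b)) : Prop :=
  ∃ (l : Fin k → ℕ) (G : ∀ j, Fin (l j) → SuperOp (a × b) (a × b)),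
    (∀ j, IsOneWayLocal (G j)) ∧
    IsCoarseGraining F' (fun p : Σ j, Fin (l j) => G p.1 p.2 ∘ₗ F p.1)

/-- Instruments implementable by finitely many rounds of LOCC. -/
inductive IsFiniteRoundLOCC : {k : ℕ} → (Fin k → SuperOp (a × b) (a × b)) → Prop
  | one {k k' : ℕ} (F : Fin k → SuperOp (a × b) (a × b)) (F' : Fin k' → SuperOp (a × b) (a × b)) :
      IsOneWayLocal F → IsCoarseGraining F' F → IsFiniteRoundLOCC F'
  | link {k k' : ℕ} (F : Fin k → SuperOp (a × b) (a × b))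
      (F' : Fin k' → SuperOp (a × b) (a × b)) :
      IsFiniteRoundLOCC F → IsLOCCLinked F' F → IsFiniteRoundLOCC F'

/-- LOCC maps on fixed local systems, with finitely or infinitely many rounds: there is a sequence
of finite-round LOCC instruments, each LOCC linked to its predecessor, whose induced maps (all
outcomes merged) converge to `N`. -/
def IsLOCCEndo (N : SuperOp (a × b) (a × b)) : Prop :=
  ∃ (k : ℕ → ℕ) (F : ∀ ν, Fin (k ν) → SuperOp (a × b) (a × b)),
    (∀ ν, IsFiniteRoundLOCC (F ν)) ∧ (∀ ν, IsLOCCLinked (F (ν + 1)) (F ν)) ∧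
    ∀ ρ, Tendsto (fun ν => (∑ j, F ν j) ρ) atTop (𝓝 (N ρ))

/-- LOCC maps between possibly different local systems: each party first locally encodes its input
into a working system of arbitrary finite dimension (for instance adds ancillas), the parties
perform LOCC on the working systems, and each party locally produces its output (for instance
discards a subsystem). -/
def IsLOCC {a' b' : Type*} [Fintype a'] [Fintype b'] (M : SuperOp (a × b) (a' × b')) : Prop :=
  ∃ (n m : ℕ) (encA : SuperOp a (Fin n)) (encB : SuperOp b (Fin m))
    (decA : SuperOp (Fin n) a') (decB : SuperOp (Fin m) b')
    (N : SuperOp (Fin n × Fin m) (Fin n × Fin m)),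
    IsChannel encA ∧ IsChannel encB ∧ IsChannel decA ∧ IsChannel decB ∧ IsLOCCEndo N ∧
    M = tensorMap decA decB ∘ₗ N ∘ₗ tensorMap encA encB

end LOCC

/-! Exact state merging. -/

/-- Amplitudes of the maximally entangled state `Φ_K^+ = K^{-1/2} ∑_l |l⟩|l⟩`. -/
def maxEntangled (K : ℕ) : Fin K × Fin K → ℂ :=
  fun x => if x.1 = x.2 then ((1 / Real.sqrt K : ℝ) : ℂ) else 0

section Merging

variable {r a b : Type*} [Fintype r] [Fintype a] [Fintype b]
  [DecidableEq r] [DecidableEq a] [DecidableEq b]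

/-- `|ψ⟩^{RAB} ⊗ |Φ_K^+⟩`, where `A` holds the systems `A` and `Abar`, and `B` holds the systems `B`
and `Bbar`; the systems are arranged as `R ⊗ ((A ⊗ Abar) ⊗ (B ⊗ Bbar))`. -/
def mergingInput (ψ : EuclideanSpace ℂ (r × a × b)) (K : ℕ) :
    r × ((a × Fin K) × (b × Fin K)) → ℂ :=
  fun x => ψ (x.1, x.2.1.1, x.2.2.1) * maxEntangled K (x.2.1.2, x.2.2.2)

/-- `|ψ⟩^{RB'B} ⊗ |Φ_L^+⟩`, where `B` holds the copy `B'` of the system `A` and the systems `B` and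
`Bbar`, and `A` holds only `Abar`; the systems are arranged as `R ⊗ (Abar ⊗ ((B' ⊗ B) ⊗ Bbar))`. -/
def mergingOutput (ψ : EuclideanSpace ℂ (r × a × b)) (L : ℕ) :
    r × (Fin L × ((a × b) × Fin L)) → ℂ :=
  fun x => ψ (x.1, x.2.2.1.1, x.2.2.1.2) * maxEntangled L (x.2.1, x.2.2.2)

/-- Exact state merging of `ψ`, consuming `Φ_K^+` and producing `Φ_L^+`, is achievable by an LOCC
map. -/
def ExactStateMerging (ψ : EuclideanSpace ℂ (r × a × b)) (K L : ℕ) : Prop :=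
  ∃ M : SuperOp ((a × Fin K) × (b × Fin K)) (Fin L × ((a × b) × Fin L)),
    IsLOCC M ∧
    tensorMap (LinearMap.id : SuperOp r r) M (pureState (mergingInput ψ K)) =
      pureState (mergingOutput ψ L)

/-- Non-catalytic exact state merging: no entanglement is produced (`L = 1`). -/
def NonCatalyticExactStateMerging (ψ : EuclideanSpace ℂ (r × a × b)) (K : ℕ) : Prop :=
  ExactStateMerging ψ K 1

/-- The entanglement costs `log₂ K` at which non-catalytic exact state merging of `ψ` is
achievable, with `K ≥ 1`. -/
def nonCatalyticCosts (ψ : EuclideanSpace ℂ (r × a × b)) : Set ℝ :=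
  {c | ∃ K : ℕ, 1 ≤ K ∧ NonCatalyticExactStateMerging ψ K ∧ c = Real.logb 2 K}

end Merging

end

/-! Everything reduces to `K = 1` against `K ≥ 2`. Since `ψ^B` is a qubit state, its largest
eigenvalue lies in `[1/2, 1]`, so `⌈2λ⌉` is `1` or `2`, and it is `1` exactly when `ψ^B = 1/2`.

For `K ≥ 2` teleportation always works: two of the `K` levels suffice to send the qubit `A`
(`merging_by_teleportation`).

For `K = 1` and `ψ^B ≠ 1/2` the obstruction is the largest squared overlap with product vectors
across the cut `RA|B`. Let `Λ = id ⊗ M` send the unit vector `φ` to `w`, and let `T = Λ†(|w⟩⟨w|)`.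
Then `0 ≤ T ≤ 1` and `⟨φ|T|φ⟩ = 1`, which forces `T ≥ |φ⟩⟨φ|`; so `|⟨φ|v⟩|²` is at most the fidelity
of `Λ(|v⟩⟨v|)` with `w`. LOCC maps are limits of channels with product Kraus operators, so for a
product `v` this fidelity is at most the best product overlap of `w` (`IsLOCC.overlap_le`). The
input attains overlap `λ`; the output, with trivial `A`, has cut `R|B'B` and overlap at most `1/2`.
Hence `λ ≤ 1/2` (`eigenvalue_le_of_merging_one`).

For `K = 1` and `ψ^B = 1/2`, slicing `ψ` along a basis of `A` gives two `2 × 2` matrices that are,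
up to scale, Kraus operators of a unital qubit channel. A change of basis of `A` turns both into
multiples of unitaries (`exists_mixing_to_unitaries`). Measuring in that basis leaves `R` and `B`
maximally entangled, and `B` rebuilds `ψ` by a local isometry (`merging_one_of_reducedB_eq`). -/

noncomputable section

/-! ### Separable maps -/

section Separable

variable {n m a b a' b' a'' b'' : Type*} [Fintype n] [Fintype a] [Fintype b]

lemma krausMap_apply {k : ℕ} (V : Fin k → Matrix m n ℂ) (ρ : Matrix n n ℂ) :
    krausMap V ρ = ∑ i, V i * ρ * (V i)ᴴ := rfl

lemma exists_eq_krausMap {ι : Type*} [Fintype ι] (V : ι → Matrix m n ℂ) :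
    ∃ e : ι ≃ Fin (Fintype.card ι), ∀ ρ,
      krausMap (fun i => V (e.symm i)) ρ = ∑ i, V i * ρ * (V i)ᴴ := by
  refine ⟨Fintype.equivFin ι, fun ρ => ?_⟩
  rw [krausMap_apply]
  exact Equiv.sum_comp (Fintype.equivFin ι).symm (fun i => V i * ρ * (V i)ᴴ)

lemma IsCompletelyPositive.of_sum {ι : Type*} [Fintype ι] (V : ι → Matrix m n ℂ)
    {Φ : SuperOp n m} (h : ∀ ρ, Φ ρ = ∑ i, V i * ρ * (V i)ᴴ) : IsCompletelyPositive Φ := by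
  obtain ⟨e, he⟩ := exists_eq_krausMap V
  exact ⟨_, _, LinearMap.ext fun ρ => (h ρ).trans (he ρ).symm⟩

/-- Maps with a Kraus representation by product operators. -/
def IsSeparableMap (Φ : SuperOp (a × b) (a' × b')) : Prop :=
  ∃ (k : ℕ) (V : Fin k → Matrix a' a ℂ) (W : Fin k → Matrix b' b ℂ),
    Φ = krausMap fun i => V i ⊗ₖ W i

lemma IsSeparableMap.of_sum {ι : Type*} [Fintype ι] (V : ι → Matrix a' a ℂ)
    (W : ι → Matrix b' b ℂ) {Φ : SuperOp (a × b) (a' × b')}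
    (h : ∀ ρ, Φ ρ = ∑ i, (V i ⊗ₖ W i) * ρ * (V i ⊗ₖ W i)ᴴ) : IsSeparableMap Φ := by
  obtain ⟨e, he⟩ := exists_eq_krausMap fun i => V i ⊗ₖ W i
  exact ⟨_, fun i => V (e.symm i), fun i => W (e.symm i),
    LinearMap.ext fun ρ => (h ρ).trans (he ρ).symm⟩

lemma IsSeparableMap.zero : IsSeparableMap (0 : SuperOp (a × b) (a' × b')) :=
  IsSeparableMap.of_sum (ι := Fin 0) (fun _ => 0) (fun _ => 0) (by simp)

lemma IsSeparableMap.add {Φ Ψ : SuperOp (a × b) (a' × b')} (hΦ : IsSeparableMap Φ)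
    (hΨ : IsSeparableMap Ψ) : IsSeparableMap (Φ + Ψ) := by
  obtain ⟨k, V, W, rfl⟩ := hΦ
  obtain ⟨k', V', W', rfl⟩ := hΨ
  exact IsSeparableMap.of_sum (Sum.elim V V') (Sum.elim W W') (by simp [krausMap_apply])

lemma IsSeparableMap.sum {ι : Type*} {s : Finset ι} {Φ : ι → SuperOp (a × b) (a' × b')}
    (h : ∀ i ∈ s, IsSeparableMap (Φ i)) : IsSeparableMap (∑ i ∈ s, Φ i) :=
  Finset.sum_induction _ _ (fun _ _ => IsSeparableMap.add) IsSeparableMap.zero h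

lemma IsSeparableMap.comp [Fintype a'] [Fintype b'] {Φ : SuperOp (a' × b') (a'' × b'')}
    {Ψ : SuperOp (a × b) (a' × b')} (hΦ : IsSeparableMap Φ) (hΨ : IsSeparableMap Ψ) :
    IsSeparableMap (Φ ∘ₗ Ψ) := by
  obtain ⟨k, V, W, rfl⟩ := hΦ
  obtain ⟨k', V', W', rfl⟩ := hΨ
  refine IsSeparableMap.of_sum (fun p : Fin k × Fin k' => V p.1 * V' p.2)
    (fun p => W p.1 * W' p.2) fun ρ => ?_
  simp only [LinearMap.comp_apply, krausMap_apply, Fintype.sum_prod_type, Matrix.mul_kronecker_mul,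
    Matrix.conjTranspose_mul, Matrix.mul_sum, Matrix.sum_mul, Matrix.mul_assoc]

lemma IsCoarseGraining.isSeparableMap {ι c d : Type*} [Fintype ι] [Fintype c] [Fintype d] {k : ℕ}
    {F' : Fin k → SuperOp (c × d) (c × d)} {F : ι → SuperOp (c × d) (c × d)}
    (h : IsCoarseGraining F' F) (hF : ∀ j, IsSeparableMap (F j)) (i : Fin k) :
    IsSeparableMap (F' i) := by
  obtain ⟨f, hf⟩ := h
  rw [hf]
  exact .sum fun j _ => hF j

end Separable

/-! ### Tensor products of maps -/

section TensorMap

variable {a b a' b' : Type*} [Fintype a] [Fintype b] [DecidableEq a] [DecidableEq b]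

lemma superOp_ext_single {n m : Type*} [Fintype n] [DecidableEq n] {Φ Ψ : SuperOp n m}
    (h : ∀ x y, Φ (Matrix.single x y 1) = Ψ (Matrix.single x y 1)) : Φ = Ψ := by
  refine LinearMap.ext fun ρ => ?_
  rw [Matrix.matrix_eq_sum_single ρ]
  simp only [map_sum]
  refine Finset.sum_congr rfl fun x _ => Finset.sum_congr rfl fun y _ => ?_
  rw [← mul_one (ρ x y), ← smul_eq_mul, ← Matrix.smul_single, map_smul, map_smul, h]

lemma tensorMap_single (Φ : SuperOp a a') (Ψ : SuperOp b b') (x y : a × b) :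
    tensorMap Φ Ψ (Matrix.single x y 1) =
      Φ (Matrix.single x.1 y.1 1) ⊗ₖ Ψ (Matrix.single x.2 y.2 1) := by
  change (∑ x' : a × b, ∑ y' : a × b, Matrix.single x y (1 : ℂ) x' y' • _) = _
  rw [Finset.sum_eq_single x, Finset.sum_eq_single y]
  · simp
  · intro y' _ h
    rw [Matrix.single_apply_of_ne, zero_smul]
    tauto
  · simp
  · intro x' _ h
    refine Finset.sum_eq_zero fun y' _ => ?_
    rw [Matrix.single_apply_of_ne, zero_smul]
    tauto
  · simp

/-- Both sides are linear in `ρ`, so matrix units suffice, and these factor as Kronecker products.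
-/
lemma tensorMap_krausMap [Fintype a'] [Fintype b'] {k l : ℕ} (V : Fin k → Matrix a' a ℂ)
    (W : Fin l → Matrix b' b ℂ) (ρ : Matrix (a × b) (a × b) ℂ) :
    tensorMap (krausMap V) (krausMap W) ρ =
      ∑ p : Fin k × Fin l, (V p.1 ⊗ₖ W p.2) * ρ * (V p.1 ⊗ₖ W p.2)ᴴ := by
  obtain ⟨e, he⟩ := exists_eq_krausMap fun p : Fin k × Fin l => V p.1 ⊗ₖ W p.2
  rw [← he]
  congr 1
  refine superOp_ext_single fun x y => ?_
  rw [he, tensorMap_single, krausMap_apply, krausMap_apply]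
  have hs : Matrix.single x y (1 : ℂ) =
      Matrix.single x.1 y.1 1 ⊗ₖ Matrix.single x.2 y.2 1 := by
    simp [Matrix.single_kronecker_single]
  rw [hs]
  simp only [Fintype.sum_prod_type, Matrix.conjTranspose_kronecker, ← Matrix.mul_kronecker_mul]
  ext i j
  simp only [Matrix.kroneckerMap_apply, Matrix.sum_apply, Finset.sum_mul_sum]

lemma IsSeparableMap.tensorMap [Fintype a'] [Fintype b'] {Φ : SuperOp a a'} {Ψ : SuperOp b b'}
    (hΦ : IsCompletelyPositive Φ) (hΨ : IsCompletelyPositive Ψ) :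
    IsSeparableMap (tensorMap Φ Ψ) := by
  obtain ⟨k, V, rfl⟩ := hΦ
  obtain ⟨l, W, rfl⟩ := hΨ
  exact IsSeparableMap.of_sum _ _ (tensorMap_krausMap V W)

lemma tensorMap_id_id : tensorMap (LinearMap.id : SuperOp a a) (LinearMap.id : SuperOp b b) =
    LinearMap.id := superOp_ext_single fun x y => by
  rw [tensorMap_single]
  simp [Matrix.single_kronecker_single]

lemma trace_tensorMap [Fintype a'] [Fintype b'] (Φ : SuperOp a a') (Ψ : SuperOp b b')
    (ρ : Matrix (a × b) (a × b) ℂ) : (tensorMap Φ Ψ ρ).trace = ∑ x : a × b, ∑ y : a × b,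
      ρ x y * ((Φ (Matrix.single x.1 y.1 1)).trace * (Ψ (Matrix.single x.2 y.2 1)).trace) := by
  change (∑ x : a × b, ∑ y : a × b, ρ x y •
    (Φ (Matrix.single x.1 y.1 1) ⊗ₖ Ψ (Matrix.single x.2 y.2 1))).trace = _
  simp only [Matrix.trace_sum, Matrix.trace_smul, Matrix.trace_kronecker, smul_eq_mul]

/-- The trace of a tensor product map is determined by traces on product matrix units; comparison
with `id ⊗ id` gives the claim. The sum over `j` is needed because the measuring party preserves the
trace only after summing over outcomes. -/
lemma isTracePreserving_sum_tensorMap [Fintype a'] [Fintype b'] {ι : Type*} [Fintype ι]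
    {E : ι → SuperOp a a'} {T : ι → SuperOp b b'}
    (h : ∀ e f, ∑ j, (E j e).trace * (T j f).trace = e.trace * f.trace) :
    IsTracePreserving (∑ j, tensorMap (E j) (T j)) := by
  intro ρ
  have h2 := trace_tensorMap (LinearMap.id : SuperOp a a) (LinearMap.id : SuperOp b b) ρ
  rw [tensorMap_id_id, LinearMap.id_apply] at h2
  rw [h2, LinearMap.sum_apply, Matrix.trace_sum]
  simp only [trace_tensorMap]
  rw [Finset.sum_comm]
  refine Finset.sum_congr rfl fun x _ => ?_
  rw [Finset.sum_comm]
  refine Finset.sum_congr rfl fun y _ => ?_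
  rw [← Finset.mul_sum, h]
  rfl

lemma IsTracePreserving.sum_trace {n m ι : Type*} [Fintype n] [Fintype m] [Fintype ι]
    {E : ι → SuperOp n m} (hE : IsTracePreserving (∑ j, E j)) (ρ : Matrix n n ℂ) :
    ∑ j, (E j ρ).trace = ρ.trace := by
  rw [← hE ρ, LinearMap.sum_apply, Matrix.trace_sum]

lemma IsTracePreserving.tensorMap [Fintype a'] [Fintype b'] {Φ : SuperOp a a'}
    {Ψ : SuperOp b b'} (hΦ : IsTracePreserving Φ) (hΨ : IsTracePreserving Ψ) :
    IsTracePreserving (tensorMap Φ Ψ) := by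
  simpa using isTracePreserving_sum_tensorMap (ι := Unit) (E := fun _ => Φ) (T := fun _ => Ψ)
    fun e f => by simp [hΦ e, hΨ f]

lemma isCompletelyPositive_id {n : Type*} [Fintype n] [DecidableEq n] :
    IsCompletelyPositive (LinearMap.id : SuperOp n n) :=
  IsCompletelyPositive.of_sum (ι := Unit) (fun _ => 1) (by simp)

lemma isChannel_id {n : Type*} [Fintype n] [DecidableEq n] :
    IsChannel (LinearMap.id : SuperOp n n) :=
  ⟨isCompletelyPositive_id, fun _ => rfl⟩

end TensorMap

/-! ### Finite-round LOCC instruments are separable -/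

section LOCCSeparable

variable {a b : Type*} [Fintype a] [Fintype b] [DecidableEq a] [DecidableEq b]

lemma IsOneWayLocal.isSeparableMap {ι : Type*} [Fintype ι] {F : ι → SuperOp (a × b) (a × b)}
    (hF : IsOneWayLocal F) (j : ι) : IsSeparableMap (F j) := by
  rcases hF with ⟨E, T, hE, hT, h⟩ | ⟨T, E, hE, hT, h⟩
  · rw [h]; exact .tensorMap (hE.1 j) (hT j).1
  · rw [h]; exact .tensorMap (hT j).1 (hE.1 j)

lemma IsOneWayLocal.isTracePreserving {ι : Type*} [Fintype ι]
    {F : ι → SuperOp (a × b) (a × b)} (hF : IsOneWayLocal F) :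
    IsTracePreserving (∑ j, F j) := by
  rcases hF with ⟨E, T, hE, hT, h⟩ | ⟨T, E, hE, hT, h⟩
  · simp only [h]
    refine isTracePreserving_sum_tensorMap fun e f => ?_
    simp only [(hT _).2 _, ← Finset.sum_mul, hE.2.sum_trace]
  · simp only [h]
    refine isTracePreserving_sum_tensorMap fun e f => ?_
    simp only [(hT _).2 _, ← Finset.mul_sum, hE.2.sum_trace]

lemma IsCoarseGraining.sum_eq {ι n : Type*} [Fintype ι] {k : ℕ} {F' : Fin k → SuperOp n n}
    {F : ι → SuperOp n n} (h : IsCoarseGraining F' F) : ∑ i, F' i = ∑ j, F j := by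
  obtain ⟨f, hf⟩ := h
  simp only [hf]
  exact Finset.sum_fiberwise _ _ _

/-- Separability holds outcome by outcome and survives composition and merging of outcomes. In a
further round each branch `F j` is followed by an instrument whose total preserves the trace of that
branch. -/
lemma IsFiniteRoundLOCC.isSeparableMap_and_isTracePreserving {k : ℕ}
    {F : Fin k → SuperOp (a × b) (a × b)} (hF : IsFiniteRoundLOCC F) :
    (∀ j, IsSeparableMap (F j)) ∧ IsTracePreserving (∑ j, F j) := by
  induction hF with
  | one F F' h1 h2 =>
    exact ⟨h2.isSeparableMap h1.isSeparableMap, h2.sum_eq ▸ h1.isTracePreserving⟩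
  | link F F' _ h ih =>
    obtain ⟨l, G, hG, hc⟩ := h
    refine ⟨hc.isSeparableMap fun p => ((hG p.1).isSeparableMap p.2).comp (ih.1 p.1), fun ρ => ?_⟩
    rw [hc.sum_eq, ← ih.2 ρ, Fintype.sum_sigma, LinearMap.sum_apply, LinearMap.sum_apply,
      Matrix.trace_sum, Matrix.trace_sum]
    refine Finset.sum_congr rfl fun j _ => ?_
    rw [← (hG j).isTracePreserving (F j ρ)]
    simp [LinearMap.sum_apply]

end LOCCSeparable

/-! ### Fidelity bounds and product overlaps -/

section OverlapBound

open scoped ComplexOrder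

section QuadraticForms

variable {n m : Type*} [Fintype n]

lemma star_dotProduct_comm (u v : n → ℂ) : star u ⬝ᵥ v = star (star v ⬝ᵥ u) := by
  simp [dotProduct, mul_comm]

lemma star_dotProduct_self (v : n → ℂ) : star v ⬝ᵥ v = ((∑ i, ‖v i‖ ^ 2 : ℝ) : ℂ) := by
  simp only [dotProduct, Pi.star_apply, RCLike.star_def, Complex.conj_mul', Complex.ofReal_sum,
    Complex.ofReal_pow]

lemma norm_star_dotProduct_sq_le (u v : n → ℂ) :
    ‖star u ⬝ᵥ v‖ ^ 2 ≤ (∑ i, ‖u i‖ ^ 2) * ∑ i, ‖v i‖ ^ 2 := by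
  refine le_trans ?_ (Finset.sum_mul_sq_le_sq_mul_sq Finset.univ (fun i => ‖u i‖) fun i => ‖v i‖)
  gcongr
  refine (norm_sum_le _ _).trans_eq ?_
  simp

/-- The expectation value `⟨w|ρ|w⟩`. -/
def expectation (w : n → ℂ) (ρ : Matrix n n ℂ) : ℂ := star w ⬝ᵥ (ρ *ᵥ w)

lemma expectation_pureState (w u : n → ℂ) :
    expectation w (pureState u) = ((‖star w ⬝ᵥ u‖ ^ 2 : ℝ) : ℂ) := by
  rw [expectation, pureState, Matrix.vecMulVec_mulVec, op_smul_eq_smul, dotProduct_smul]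
  rw [star_dotProduct_comm u w, smul_eq_mul, RCLike.star_def, Complex.conj_mul',
    Complex.ofReal_pow]

lemma expectation_sum {ι : Type*} (s : Finset ι) (w : n → ℂ) (ρ : ι → Matrix n n ℂ) :
    expectation w (∑ i ∈ s, ρ i) = ∑ i ∈ s, expectation w (ρ i) := by
  simp only [expectation, Matrix.sum_mulVec, dotProduct_sum]

lemma expectation_smul (w : n → ℂ) (c : ℂ) (ρ : Matrix n n ℂ) :
    expectation w (c • ρ) = c * expectation w ρ := by
  simp only [expectation, Matrix.smul_mulVec, dotProduct_smul, smul_eq_mul]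

lemma continuous_expectation (w : n → ℂ) : Continuous (expectation w) := by
  unfold expectation
  fun_prop

lemma trace_pureState (v : n → ℂ) : (pureState v).trace = ((∑ i, ‖v i‖ ^ 2 : ℝ) : ℂ) := by
  rw [pureState, Matrix.trace_vecMulVec, dotProduct_comm, star_dotProduct_self]

lemma mul_pureState_mul (V : Matrix m n ℂ) (v : n → ℂ) :
    V * pureState v * Vᴴ = pureState (V *ᵥ v) := by
  rw [pureState, pureState, Matrix.mul_vecMulVec, Matrix.vecMulVec_mul, Matrix.star_mulVec]

lemma krausMap_pureState {k : ℕ} (V : Fin k → Matrix m n ℂ) (v : n → ℂ) :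
    krausMap V (pureState v) = ∑ i, pureState (V i *ᵥ v) := by
  simp only [krausMap_apply, mul_pureState_mul]

lemma expectation_krausMap [Fintype m] {k : ℕ} (V : Fin k → Matrix m n ℂ) (w : m → ℂ)
    (v : n → ℂ) :
    expectation w (krausMap V (pureState v)) = ((∑ i, ‖star w ⬝ᵥ (V i *ᵥ v)‖ ^ 2 : ℝ) : ℂ) := by
  simp only [krausMap_pureState, expectation_sum, expectation_pureState, Complex.ofReal_sum]

lemma sum_norm_krausMap [Fintype m] {k : ℕ} {V : Fin k → Matrix m n ℂ}
    (h : IsTracePreserving (krausMap V)) (v : n → ℂ) :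
    ∑ i, ∑ x, ‖(V i *ᵥ v) x‖ ^ 2 = ∑ x, ‖v x‖ ^ 2 := by
  have := h (pureState v)
  rw [krausMap_pureState, Matrix.trace_sum] at this
  simp only [trace_pureState] at this
  exact_mod_cast this

/-- The matrix of `Φ† (|w⟩⟨w|)`. -/
def pullbackMatrix [Fintype m] [DecidableEq n] (Φ : SuperOp n m) (w : m → ℂ) : Matrix n n ℂ :=
  Matrix.of fun x y => expectation w (Φ (Matrix.single y x 1))

lemma expectation_pullbackMatrix [Fintype m] [DecidableEq n] (Φ : SuperOp n m) (w : m → ℂ)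
    (v : n → ℂ) :
    expectation v (pullbackMatrix Φ w) = expectation w (Φ (pureState v)) := by
  conv_rhs => rw [Matrix.matrix_eq_sum_single (pureState v)]
  have hs : ∀ x y, Matrix.single x y (pureState v x y) =
      (v x * star (v y)) • Matrix.single x y (1 : ℂ) := fun x y => by
    rw [Matrix.smul_single, smul_eq_mul, mul_one]; rfl
  simp only [hs, map_sum, map_smul, expectation_sum, expectation_smul]
  rw [Finset.sum_comm]
  simp only [expectation, dotProduct, mulVec, pullbackMatrix, Matrix.of_apply, Finset.mul_sum,
    Pi.star_apply]
  refine Finset.sum_congr rfl fun x _ => Finset.sum_congr rfl fun y _ => ?_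
  simp only [Finset.mul_sum, Finset.sum_mul]
  refine Finset.sum_congr rfl fun z _ => Finset.sum_congr rfl fun z' _ => ?_
  ring

/-- Over `ℂ`, a real-valued quadratic form already forces the matrix to be Hermitian. -/
lemma posSemidef_of_expectation_nonneg {T : Matrix n n ℂ} (h : ∀ v, 0 ≤ expectation v T) :
    T.PosSemidef := by
  classical
  refine Matrix.posSemidef_iff_dotProduct_mulVec.2 ⟨?_, h⟩
  rw [← Matrix.isSymmetric_toEuclideanLin_iff, LinearMap.isSymmetric_iff_inner_map_self_real]
  intro v
  have h1 : inner ℂ v (Matrix.toEuclideanLin T v) = expectation v.ofLp T := by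
    rw [EuclideanSpace.inner_eq_star_dotProduct, dotProduct_comm]
    rfl
  have h2 : star (expectation v.ofLp T) = expectation v.ofLp T :=
    (IsSelfAdjoint.of_nonneg (h _)).star_eq
  rw [inner_conj_symm, h1, ← inner_conj_symm, h1]
  exact h2.symm

/-- This is `|φ⟩⟨φ| ≤ T`: a unit vector at which `T ≤ 1` attains its bound is fixed by `T`, so `T`
has no cross terms between `φ` and its orthogonal complement, where it is still nonnegative. -/
lemma norm_dotProduct_sq_le_expectation [DecidableEq n] {T : Matrix n n ℂ} (φ : n → ℂ)
    (h0 : ∀ v, 0 ≤ expectation v T) (h1 : ∀ v, expectation v T ≤ star v ⬝ᵥ v)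
    (hφ : star φ ⬝ᵥ φ = 1) (hT : expectation φ T = 1) (v : n → ℂ) :
    ((‖star φ ⬝ᵥ v‖ ^ 2 : ℝ) : ℂ) ≤ expectation v T := by
  have hP := posSemidef_of_expectation_nonneg h0
  have hQ : (1 - T).PosSemidef := posSemidef_of_expectation_nonneg fun v => by
    have := h1 v
    simpa [expectation, Matrix.sub_mulVec] using this
  -- The positive semidefinite `1 - T` has zero expectation at `φ`, so it annihilates `φ`.
  have hfix : T *ᵥ φ = φ := by
    have h2 := (hQ.dotProduct_mulVec_zero_iff φ).1 (by
      rw [Matrix.sub_mulVec, Matrix.one_mulVec, dotProduct_sub, hφ]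
      exact sub_eq_zero.2 hT.symm)
    rw [Matrix.sub_mulVec, Matrix.one_mulVec, sub_eq_zero] at h2
    exact h2.symm
  have hfix' : ∀ u, star φ ⬝ᵥ (T *ᵥ u) = star φ ⬝ᵥ u := fun u => by
    rw [Matrix.dotProduct_mulVec, ← hP.1.eq, ← Matrix.star_mulVec, hfix]
  -- Nonnegativity of `T` on the component of `v` orthogonal to `φ`.
  have h3 := h0 (v - (star φ ⬝ᵥ v) • φ)
  have h4 : expectation (v - (star φ ⬝ᵥ v) • φ) T =
      expectation v T - ((‖star φ ⬝ᵥ v‖ ^ 2 : ℝ) : ℂ) := by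
    have h5 := star_dotProduct_comm v φ
    simp only [expectation, Matrix.mulVec_sub, Matrix.mulVec_smul, hfix, star_sub, star_smul,
      dotProduct_sub, sub_dotProduct, smul_dotProduct, dotProduct_smul, hfix', hφ, h5, smul_eq_mul]
    rw [Complex.ofReal_pow, ← Complex.conj_mul', RCLike.star_def]
    ring
  rw [h4] at h3
  exact sub_nonneg.1 h3

/-- If a limit of channels maps a unit vector `φ` to a unit vector `w`, then the fidelity with any
other state does not decrease. -/
lemma norm_dotProduct_sq_le_of_tendsto [Fintype m] [DecidableEq n] {P : SuperOp n m} {Q : ℕ → SuperOp n m}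
    (hQ : ∀ ν, IsChannel (Q ν)) (hlim : ∀ ρ, Tendsto (fun ν => Q ν ρ) atTop (𝓝 (P ρ)))
    {φ : n → ℂ} {w : m → ℂ} (hφ : star φ ⬝ᵥ φ = 1) (hw : star w ⬝ᵥ w = 1)
    (hP : P (pureState φ) = pureState w) (v : n → ℂ) :
    ((‖star φ ⬝ᵥ v‖ ^ 2 : ℝ) : ℂ) ≤ expectation w (P (pureState v)) := by
  have hlim' : ∀ u : n → ℂ, Tendsto (fun ν => expectation w (Q ν (pureState u))) atTop
      (𝓝 (expectation w (P (pureState u)))) := fun u =>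
    ((continuous_expectation w).tendsto _).comp (hlim _)
  -- The bounds `0 ≤ T ≤ 1` for the pullback `T` of `|w⟩⟨w|` are checked for each `Q ν` and passed
  -- to the limit, so `P` itself need not be shown to be a channel.
  rw [← expectation_pullbackMatrix]
  refine norm_dotProduct_sq_le_expectation φ (fun u => ?_) (fun u => ?_) hφ ?_ v
  · rw [expectation_pullbackMatrix]
    refine ge_of_tendsto' (hlim' u) fun ν => ?_
    obtain ⟨⟨k, V, hV⟩, -⟩ := hQ ν
    rw [hV, expectation_krausMap]
    exact_mod_cast Finset.sum_nonneg fun i _ => by positivity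
  · rw [expectation_pullbackMatrix]
    refine le_of_tendsto' (hlim' u) fun ν => ?_
    obtain ⟨⟨k, V, hV⟩, hT⟩ := hQ ν
    rw [hV] at hT ⊢
    rw [expectation_krausMap, star_dotProduct_self, ← sum_norm_krausMap hT]
    rw [star_dotProduct_self] at hw
    have hw' : ∑ i, ‖w i‖ ^ 2 = 1 := by exact_mod_cast hw
    exact_mod_cast Finset.sum_le_sum fun i _ => by
      simpa [hw'] using norm_star_dotProduct_sq_le w (V i *ᵥ u)
  · rw [expectation_pullbackMatrix, hP, expectation_pureState, hw]
    simp

end QuadraticForms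

section ProductVectors

variable {r a b a' b' : Type*} [Fintype r] [Fintype a] [Fintype b] [Fintype a'] [Fintype b']
  [DecidableEq r] [DecidableEq a] [DecidableEq b]

/-- The product of a vector of `R ⊗ A` and a vector of `B`, as a vector of `R ⊗ (A ⊗ B)`. -/
def cutProduct (x : r × a → ℂ) (y : b → ℂ) : r × (a × b) → ℂ :=
  fun p => x (p.1, p.2.1) * y p.2.2

omit [DecidableEq r] [DecidableEq a] [DecidableEq b] in
lemma sum_norm_cutProduct (x : r × a → ℂ) (y : b → ℂ) :
    ∑ p, ‖cutProduct x y p‖ ^ 2 = (∑ p, ‖x p‖ ^ 2) * ∑ p, ‖y p‖ ^ 2 := by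
  simp only [cutProduct, norm_mul, mul_pow, Fintype.sum_prod_type, Finset.sum_mul_sum]
  simp only [Finset.sum_mul]
  exact Finset.sum_congr rfl fun _ _ => Finset.sum_comm

omit [DecidableEq a] [DecidableEq b] [Fintype a'] [Fintype b'] in
lemma one_kronecker_mulVec_cutProduct (V : Matrix a' a ℂ) (W : Matrix b' b ℂ) (x : r × a → ℂ)
    (y : b → ℂ) : ((1 : Matrix r r ℂ) ⊗ₖ (V ⊗ₖ W)) *ᵥ cutProduct x y =
      cutProduct (((1 : Matrix r r ℂ) ⊗ₖ V) *ᵥ x) (W *ᵥ y) := by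
  ext ⟨i, j, k⟩
  simp only [cutProduct, mulVec, dotProduct, Fintype.sum_prod_type, Matrix.kroneckerMap_apply,
    Matrix.one_apply, Finset.sum_mul]
  refine Finset.sum_congr rfl fun i' _ => Finset.sum_congr rfl fun j' _ => ?_
  rw [Finset.mul_sum]
  refine Finset.sum_congr rfl fun k' _ => ?_
  ring

/-- Product Kraus operators, extended by the identity on `R`, map vectors that are product across
`RA|B` to such vectors, and the squared norms of the images add up to that of the input. -/
lemma expectation_tensorMap_id_le {M : SuperOp (a × b) (a' × b')} (hM : IsSeparableMap M)
    (hT : IsTracePreserving M) {w : r × (a' × b') → ℂ} {c : ℝ}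
    (hw : ∀ x y, ‖star w ⬝ᵥ cutProduct x y‖ ^ 2 ≤ c * ((∑ p, ‖x p‖ ^ 2) * ∑ p, ‖y p‖ ^ 2))
    (x : r × a → ℂ) (y : b → ℂ) :
    expectation w (tensorMap (LinearMap.id : SuperOp r r) M (pureState (cutProduct x y))) ≤
      ((c * ((∑ p, ‖x p‖ ^ 2) * ∑ p, ‖y p‖ ^ 2) : ℝ) : ℂ) := by
  obtain ⟨k, V, W, rfl⟩ := hM
  have hid : (LinearMap.id : SuperOp r r) = krausMap fun _ : Fin 1 => 1 :=
    LinearMap.ext fun ρ => by simp [krausMap_apply]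
  have hTP := IsTracePreserving.tensorMap (Φ := (LinearMap.id : SuperOp r r)) (fun _ => rfl) hT
  have hK : tensorMap (LinearMap.id : SuperOp r r) (krausMap fun i => V i ⊗ₖ W i) =
      krausMap fun i => (1 : Matrix r r ℂ) ⊗ₖ (V i ⊗ₖ W i) := LinearMap.ext fun ρ => by
    rw [hid, tensorMap_krausMap, krausMap_apply, Fintype.sum_prod_type]
    simp
  rw [hK] at hTP ⊢
  rw [expectation_krausMap, ← sum_norm_cutProduct, ← sum_norm_krausMap hTP, Finset.mul_sum]
  refine Complex.real_le_real.2 (Finset.sum_le_sum fun i _ => ?_)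
  rw [one_kronecker_mulVec_cutProduct, sum_norm_cutProduct]
  exact hw _ _

end ProductVectors

end OverlapBound

/-! ### Converse: merging without entanglement forces small eigenvalues -/

section Converse

open scoped ComplexOrder

variable {r a b a' b' : Type*} [Fintype r] [Fintype a] [Fintype b] [Fintype a'] [Fintype b']
  [DecidableEq r] [DecidableEq a] [DecidableEq b]

/-- Separability of the limit is not needed: the overlap bounds are closed conditions and pass to
the limit. -/
lemma IsLOCC.exists_tendsto {M : SuperOp (a × b) (a' × b')} (hM : IsLOCC M) :
    ∃ Q : ℕ → SuperOp (a × b) (a' × b'),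
      (∀ ν, IsSeparableMap (Q ν) ∧ IsTracePreserving (Q ν)) ∧
      ∀ ρ, Tendsto (fun ν => Q ν ρ) atTop (𝓝 (M ρ)) := by
  obtain ⟨n, m, encA, encB, decA, decB, N, hA, hB, hA', hB', ⟨k, F, hF, -, hlim⟩, rfl⟩ := hM
  refine ⟨fun ν => tensorMap decA decB ∘ₗ (∑ j, F ν j) ∘ₗ tensorMap encA encB,
    fun ν => ⟨?_, fun ρ => ?_⟩, fun ρ => ?_⟩
  · exact (IsSeparableMap.tensorMap hA'.1 hB'.1).comp
      ((IsSeparableMap.sum fun j _ => (hF ν).isSeparableMap_and_isTracePreserving.1 j).comp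
        (IsSeparableMap.tensorMap hA.1 hB.1))
  · simp only [LinearMap.comp_apply]
    rw [IsTracePreserving.tensorMap hA'.2 hB'.2,
      (hF ν).isSeparableMap_and_isTracePreserving.2, IsTracePreserving.tensorMap hA.2 hB.2]
  · exact ((LinearMap.continuous_of_finiteDimensional (tensorMap decA decB)).tendsto _).comp
      (hlim (tensorMap encA encB ρ))

omit [Fintype a'] in
lemma tendsto_tensorMap_id {M : SuperOp a a'} {Q : ℕ → SuperOp a a'}
    (h : ∀ ρ, Tendsto (fun ν => Q ν ρ) atTop (𝓝 (M ρ))) (ρ : Matrix (r × a) (r × a) ℂ) :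
    Tendsto (fun ν => tensorMap (LinearMap.id : SuperOp r r) (Q ν) ρ) atTop
      (𝓝 (tensorMap (LinearMap.id : SuperOp r r) M ρ)) := by
  refine tendsto_finsetSum _ fun x _ => tendsto_finsetSum _ fun y _ => Tendsto.const_smul ?_ _
  refine tendsto_pi_nhds.2 fun i => tendsto_pi_nhds.2 fun j => ?_
  simp only [Matrix.kroneckerMap_apply]
  exact Tendsto.const_mul _
    (tendsto_pi_nhds.1 (tendsto_pi_nhds.1 (h (Matrix.single x.2 y.2 1)) i.2) j.2)

lemma isChannel_tensorMap_id {M : SuperOp (a × b) (a' × b')}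
    (h : IsSeparableMap M) (hT : IsTracePreserving M) :
    IsChannel (tensorMap (LinearMap.id : SuperOp r r) M) := by
  obtain ⟨k, V, W, rfl⟩ := h
  obtain ⟨l, V', W', h'⟩ := IsSeparableMap.tensorMap (isCompletelyPositive_id (n := r))
    (⟨k, _, rfl⟩ : IsCompletelyPositive (krausMap fun i => V i ⊗ₖ W i))
  exact ⟨⟨l, _, h'⟩, IsTracePreserving.tensorMap (fun _ => rfl) hT⟩

/-- The largest squared overlap with product states does not increase under LOCC maps between
pure states. -/
lemma IsLOCC.overlap_le {M : SuperOp (a × b) (a' × b')} (hM : IsLOCC M)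
    {φ : r × (a × b) → ℂ} {w : r × (a' × b') → ℂ} (hφ : star φ ⬝ᵥ φ = 1) (hw : star w ⬝ᵥ w = 1)
    (h : tensorMap (LinearMap.id : SuperOp r r) M (pureState φ) = pureState w) {c : ℝ}
    (hc : ∀ x y, ‖star w ⬝ᵥ cutProduct x y‖ ^ 2 ≤ c * ((∑ p, ‖x p‖ ^ 2) * ∑ p, ‖y p‖ ^ 2))
    (x : r × a → ℂ) (y : b → ℂ) :
    ‖star φ ⬝ᵥ cutProduct x y‖ ^ 2 ≤ c * ((∑ p, ‖x p‖ ^ 2) * ∑ p, ‖y p‖ ^ 2) := by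
  obtain ⟨Q, hQ, hlim⟩ := hM.exists_tendsto
  have hlim' := tendsto_tensorMap_id (r := r) hlim
  have h1 := norm_dotProduct_sq_le_of_tendsto
    (fun ν => isChannel_tensorMap_id (r := r) (hQ ν).1 (hQ ν).2) hlim' hφ hw h (cutProduct x y)
  have h2 := le_of_tendsto' (((continuous_expectation w).tendsto _).comp
    (hlim' (pureState (cutProduct x y)))) fun ν =>
      expectation_tensorMap_id_le (hQ ν).1 (hQ ν).2 hc x y
  exact Complex.real_le_real.1 (h1.trans h2)

lemma sum_norm_sq_eq_of_norm_eq_one {n : Type*} [Fintype n] {ψ : EuclideanSpace ℂ n}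
    (h : ‖ψ‖ = 1) : ∑ x, ‖ψ x‖ ^ 2 = 1 := by
  rw [← EuclideanSpace.norm_sq_eq, h, one_pow]

omit [DecidableEq a] [DecidableEq b] in
-- Expanding the square, the left side is `⟨x|ψ^R|x⟩`.
lemma sum_norm_sq_of_reducedR_eq {ψ : EuclideanSpace ℂ (r × a × b)} {c : ℝ}
    (hR : reducedR ψ = (c : ℂ) • (1 : Matrix r r ℂ)) (x : r → ℂ) :
    ∑ q, ‖∑ i, star (ψ (i, q)) * x i‖ ^ 2 = c * ∑ i, ‖x i‖ ^ 2 := by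
  have h : ∀ i i', ∑ q, ψ (i, q) * star (ψ (i', q)) = if i = i' then (c : ℂ) else 0 := by
    intro i i'
    have := congrFun (congrFun hR i) i'
    simpa [reducedR, traceSnd, pureState, Matrix.vecMulVec_apply, Matrix.one_apply] using this
  apply Complex.ofReal_injective
  push_cast
  simp only [← Complex.conj_mul']
  calc ∑ q, starRingEnd ℂ (∑ i, star (ψ (i, q)) * x i) * ∑ i, star (ψ (i, q)) * x i
      = ∑ i, ∑ i', star (x i) * x i' * ∑ q, ψ (i, q) * star (ψ (i', q)) := by
        simp only [map_sum, map_mul, Finset.sum_mul_sum, RCLike.star_def, Complex.conj_conj]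
        rw [Finset.sum_comm]
        refine Finset.sum_congr rfl fun i _ => ?_
        rw [Finset.sum_comm]
        refine Finset.sum_congr rfl fun i' _ => ?_
        rw [Finset.mul_sum]
        refine Finset.sum_congr rfl fun q _ => ?_
        ring
    _ = _ := by
        simp only [h, mul_ite, mul_zero, Finset.sum_ite_eq, Finset.mem_univ, if_true,
          Finset.mul_sum]
        refine Finset.sum_congr rfl fun i _ => ?_
        rw [RCLike.star_def]
        ring

omit [Fintype r] [Fintype a] [Fintype b] [DecidableEq r] [DecidableEq a] [DecidableEq b] in
lemma mergingInput_one_apply (ψ : EuclideanSpace ℂ (r × a × b)) (i : r) (k : a) (j : b) :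
    mergingInput ψ 1 (i, (k, 0), (j, 0)) = ψ (i, k, j) := by
  simp [mergingInput, maxEntangled]

omit [Fintype r] [Fintype a] [Fintype b] [DecidableEq r] [DecidableEq a] [DecidableEq b] in
lemma mergingOutput_one_apply (ψ : EuclideanSpace ℂ (r × a × b)) (i : r) (q : a × b) :
    mergingOutput ψ 1 (i, 0, (q, 0)) = ψ (i, q) := by
  simp [mergingOutput, maxEntangled]

omit [Fintype b] [DecidableEq r] [DecidableEq a] [DecidableEq b] in
lemma reducedB_apply (ψ : EuclideanSpace ℂ (r × a × b)) (j j' : b) :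
    reducedB ψ j j' = ∑ p : r × a, ψ (p.1, p.2, j) * star (ψ (p.1, p.2, j')) := by
  simp only [reducedB, traceFst, Matrix.of_apply, pureState, Matrix.vecMulVec_apply,
    Pi.star_apply, Fintype.sum_prod_type]
  exact Finset.sum_comm

omit [DecidableEq r] [DecidableEq a] [DecidableEq b] in
lemma star_dotProduct_reducedB_mulVec (ψ : EuclideanSpace ℂ (r × a × b)) (β : b → ℂ) :
    star β ⬝ᵥ (reducedB ψ *ᵥ β) =
      ((∑ p : r × a, ‖∑ j, star (β j) * ψ (p.1, p.2, j)‖ ^ 2 : ℝ) : ℂ) := by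
  push_cast
  simp only [← Complex.mul_conj', map_sum, map_mul, RCLike.star_def, Complex.conj_conj,
    Finset.sum_mul_sum, mulVec, dotProduct, reducedB_apply, Pi.star_apply]
  rw [Finset.sum_comm]
  refine Finset.sum_congr rfl fun j _ => ?_
  rw [Finset.sum_comm, Finset.mul_sum]
  refine Finset.sum_congr rfl fun j' _ => ?_
  rw [Finset.sum_mul, Finset.mul_sum]
  refine Finset.sum_congr rfl fun p _ => ?_
  ring

omit [DecidableEq a] [DecidableEq b] in
-- After merging `A` holds a one-dimensional system, so the cut is `R|B'B`. Contracting with `x`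
-- first and applying Cauchy–Schwarz on `B'B` leaves the factor `⟨x|ψ^R|x⟩`.
lemma star_mergingOutput_dotProduct_le {ψ : EuclideanSpace ℂ (r × a × b)} {c : ℝ}
    (hR : reducedR ψ = (c : ℂ) • (1 : Matrix r r ℂ)) (x : r × Fin 1 → ℂ)
    (y : (a × b) × Fin 1 → ℂ) :
    ‖star (mergingOutput ψ 1) ⬝ᵥ cutProduct x y‖ ^ 2 ≤
      c * ((∑ p, ‖x p‖ ^ 2) * ∑ p, ‖y p‖ ^ 2) := by
  have h1 : star (mergingOutput ψ 1) ⬝ᵥ cutProduct x y =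
      ∑ q, (∑ i, star (ψ (i, q)) * x (i, 0)) * y (q, 0) := by
    simp only [dotProduct, cutProduct, Finset.sum_mul]
    rw [Finset.sum_comm, Fintype.sum_prod_type]
    simp [Fintype.sum_prod_type, mul_assoc, mergingOutput_one_apply]
  have h2 := norm_star_dotProduct_sq_le
    (fun q => star (∑ i, star (ψ (i, q)) * x (i, 0))) fun q => y (q, 0)
  simp only [dotProduct, Pi.star_apply, star_star, norm_star,
    sum_norm_sq_of_reducedR_eq hR fun i => x (i, 0)] at h2
  rw [h1]
  refine h2.trans_eq ?_
  simp [Fintype.sum_prod_type, mul_assoc]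

/-- Merging without entanglement bounds the eigenvalues of `ψ^B`. -/
lemma eigenvalue_le_of_merging_one {ψ : EuclideanSpace ℂ (r × a × b)} (hψ : ‖ψ‖ = 1) {c : ℝ}
    (hc : 0 ≤ c) (hR : reducedR ψ = (c : ℂ) • (1 : Matrix r r ℂ))
    (hm : NonCatalyticExactStateMerging ψ 1) {lam : ℝ}
    (hlam : Module.End.HasEigenvalue (Matrix.toLin' (reducedB ψ)) (lam : ℂ)) : lam ≤ c := by
  obtain ⟨M, hM, h⟩ := hm
  obtain ⟨β, hβ⟩ := hlam.exists_hasEigenvector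
  have hβ0 := hβ.2
  have hβe : reducedB ψ *ᵥ β = (lam : ℂ) • β := by
    simpa using hβ.apply_eq_smul
  have hnorm := sum_norm_sq_eq_of_norm_eq_one hψ
  have hin : star (mergingInput ψ 1) ⬝ᵥ mergingInput ψ 1 = 1 := by
    rw [star_dotProduct_self, ← Complex.ofReal_one, ← hnorm]
    simp [mergingInput_one_apply, Fintype.sum_prod_type]
  have hout : star (mergingOutput ψ 1) ⬝ᵥ mergingOutput ψ 1 = 1 := by
    rw [star_dotProduct_self, ← Complex.ofReal_one, ← hnorm]
    simp [mergingOutput_one_apply, Fintype.sum_prod_type]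
  -- `X = ⟨β|ψ⟩` is the best partner of the eigenvector `β`: both `‖X‖²` and the overlap of `ψ` with
  -- `X ⊗ β` equal `lam * ‖β‖²`.
  set X : r × a → ℂ := fun p => ∑ j, star (β j) * ψ (p.1, p.2, j) with hX
  have key := hM.overlap_le hin hout h (star_mergingOutput_dotProduct_le hR)
    (fun p => X (p.1, p.2.1)) (fun q => β q.1)
  have h1 : star (mergingInput ψ 1) ⬝ᵥ cutProduct (fun p => X (p.1, p.2.1)) (fun q => β q.1) =
      ((∑ p, ‖X p‖ ^ 2 : ℝ) : ℂ) := by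
    simp only [dotProduct, cutProduct, Fintype.sum_prod_type]
    push_cast
    simp only [← Complex.conj_mul', Pi.star_apply, Finset.univ_unique, Finset.sum_singleton,
      Fin.default_eq_zero, mergingInput_one_apply]
    refine Finset.sum_congr rfl fun i _ => Finset.sum_congr rfl fun k _ => ?_
    conv_rhs => rw [hX]
    simp only [map_sum, map_mul, RCLike.star_def, Complex.conj_conj, Finset.sum_mul]
    refine Finset.sum_congr rfl fun j _ => ?_
    rw [hX]
    simp only [RCLike.star_def]
    ring
  have h2 : ∑ p, ‖X p‖ ^ 2 = lam * ∑ j, ‖β j‖ ^ 2 := by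
    apply Complex.ofReal_injective
    rw [hX, ← star_dotProduct_reducedB_mulVec, hβe, dotProduct_smul, star_dotProduct_self]
    simp
  rw [h1, h2] at key
  have hpos : 0 < ∑ j, ‖β j‖ ^ 2 := by
    obtain ⟨j, hj⟩ := Function.ne_iff.1 hβ0
    exact Finset.sum_pos' (fun _ _ => by positivity) ⟨j, Finset.mem_univ _, by
      have : 0 < ‖β j‖ := norm_pos_iff.2 hj
      positivity⟩
  have h5 : ∑ p : r × (a × Fin 1), ‖X (p.1, p.2.1)‖ ^ 2 = lam * ∑ j, ‖β j‖ ^ 2 := by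
    rw [← h2]; simp [Fintype.sum_prod_type]
  have h6 : ∑ q : b × Fin 1, ‖β q.1‖ ^ 2 = ∑ j, ‖β j‖ ^ 2 := by
    simp [Fintype.sum_prod_type]
  rw [h5, h6, Complex.norm_real, Real.norm_eq_abs, sq_abs] at key
  -- With `s = ‖β‖²`, `key` reads `(lam s)² ≤ c · lam s · s`; if `c < lam`, then `lam > 0` and the
  -- factor `lam s²` cancels.
  by_contra! hlt
  have hl : 0 < lam := hc.trans_lt hlt
  have : lam * (lam * (∑ j, ‖β j‖ ^ 2) ^ 2) ≤ c * (lam * (∑ j, ‖β j‖ ^ 2) ^ 2) := by linarith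
  exact absurd (le_of_mul_le_mul_right this (by positivity)) (not_le.2 hlt)

end Converse

/-! ### Channels, isometries and their left inverses -/

section Channels

variable {n m l : Type*} [Fintype n] [Fintype m]

lemma isTracePreserving_of_sum_eq_one [DecidableEq n] {ι : Type*} [Fintype ι]
    {V : ι → Matrix m n ℂ} {Φ : SuperOp n m} (hΦ : ∀ ρ, Φ ρ = ∑ i, V i * ρ * (V i)ᴴ)
    (hV : ∑ i, (V i)ᴴ * V i = 1) : IsTracePreserving Φ := by
  intro ρ
  rw [hΦ, Matrix.trace_sum]
  simp only [Matrix.trace_mul_comm (V _ * ρ), ← Matrix.mul_assoc]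
  rw [← Matrix.trace_sum, ← Matrix.sum_mul, hV, Matrix.one_mul]

/-- The map `ρ ↦ V * ρ * Vᴴ`. -/
def conjMap (V : Matrix m n ℂ) : SuperOp n m := krausMap fun _ : Fin 1 => V

omit [Fintype m] in
lemma conjMap_apply (V : Matrix m n ℂ) (ρ : Matrix n n ℂ) : conjMap V ρ = V * ρ * Vᴴ := by
  simp [conjMap, krausMap_apply]

lemma isChannel_conjMap [DecidableEq n] {V : Matrix m n ℂ} (hV : Vᴴ * V = 1) :
    IsChannel (conjMap V) :=
  ⟨⟨_, _, rfl⟩, isTracePreserving_of_sum_eq_one (V := fun _ : Fin 1 => V) (fun _ => rfl)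
    (by simpa using hV)⟩

/-- The Kraus operator `Vᴴ` undoes `V` on its range; the operators `|x₀⟩⟨i|(1 - V Vᴴ)` send the
orthogonal complement to a fixed state, which restores trace preservation. -/
lemma exists_channel_comp_conjMap_eq_id [DecidableEq n] [DecidableEq m] [Nonempty n]
    {V : Matrix m n ℂ} (hV : Vᴴ * V = 1) :
    ∃ Φ : SuperOp m n, IsChannel Φ ∧ Φ ∘ₗ conjMap V = LinearMap.id := by
  obtain ⟨x₀⟩ := ‹Nonempty n›
  let K : Option m → Matrix n m ℂ := fun o => o.elim Vᴴ fun i =>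
    Matrix.single x₀ i (1 : ℂ) * (1 - V * Vᴴ)
  obtain ⟨e, he⟩ := exists_eq_krausMap K
  refine ⟨_, ⟨⟨_, _, rfl⟩, isTracePreserving_of_sum_eq_one he ?_⟩, LinearMap.ext fun ρ => ?_⟩
  · have h1 : (1 - V * Vᴴ)ᴴ = 1 - V * Vᴴ := by simp
    have h2 : (1 - V * Vᴴ) * (1 - V * Vᴴ) = 1 - V * Vᴴ := by
      have : V * Vᴴ * (V * Vᴴ) = V * Vᴴ := by
        rw [Matrix.mul_assoc, ← Matrix.mul_assoc Vᴴ, hV, Matrix.one_mul]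
      rw [Matrix.mul_sub, Matrix.mul_one, Matrix.sub_mul, Matrix.one_mul, this, sub_self, sub_zero]
    have h3 : ∑ i : m, Matrix.single i i (1 : ℂ) = 1 := by
      ext i j
      simp [Matrix.sum_apply, Matrix.single_apply, Matrix.one_apply, ite_and]
    have h4 : ∀ i : m, (Matrix.single x₀ i (1 : ℂ) * (1 - V * Vᴴ))ᴴ *
        (Matrix.single x₀ i (1 : ℂ) * (1 - V * Vᴴ)) =
          (1 - V * Vᴴ) * Matrix.single i i 1 * (1 - V * Vᴴ) := fun i => by
      rw [Matrix.conjTranspose_mul, h1, Matrix.conjTranspose_single, Matrix.mul_assoc,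
        ← Matrix.mul_assoc (Matrix.single i x₀ _), Matrix.single_mul_single_same,
        Matrix.mul_assoc]
      simp
    rw [Fintype.sum_option]
    simp only [K, Option.elim, Matrix.conjTranspose_conjTranspose, h4]
    rw [← Matrix.sum_mul, ← Matrix.mul_sum, h3, Matrix.mul_one, h2]
    simp
  · have h5 : (1 - V * Vᴴ) * V = 0 := by
      rw [Matrix.sub_mul, Matrix.mul_assoc, hV]; simp
    have h6 : ∀ i : m, Matrix.single x₀ i (1 : ℂ) * (1 - V * Vᴴ) * (V * ρ * Vᴴ) = 0 := fun i => by
      rw [Matrix.mul_assoc V, ← Matrix.mul_assoc, Matrix.mul_assoc _ _ V, h5]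
      simp
    rw [LinearMap.comp_apply, conjMap_apply, he, Fintype.sum_option]
    simp only [K, Option.elim, h6, Matrix.zero_mul, Finset.sum_const_zero, add_zero,
      Matrix.conjTranspose_conjTranspose, LinearMap.id_apply]
    rw [Matrix.mul_assoc, Matrix.mul_assoc, hV, ← Matrix.mul_assoc, ← Matrix.mul_assoc, hV]
    simp

lemma IsCompletelyPositive.comp {Φ : SuperOp m l} {Ψ : SuperOp n m}
    (hΦ : IsCompletelyPositive Φ) (hΨ : IsCompletelyPositive Ψ) :
    IsCompletelyPositive (Φ ∘ₗ Ψ) := by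
  obtain ⟨k, V, rfl⟩ := hΦ
  obtain ⟨k', W, rfl⟩ := hΨ
  refine .of_sum (fun p : Fin k × Fin k' => V p.1 * W p.2) fun ρ => ?_
  simp only [LinearMap.comp_apply, krausMap_apply, Fintype.sum_prod_type,
    Matrix.conjTranspose_mul, Matrix.mul_sum, Matrix.sum_mul, Matrix.mul_assoc]

lemma IsChannel.comp [Fintype l] {Φ : SuperOp m l} {Ψ : SuperOp n m} (hΦ : IsChannel Φ)
    (hΨ : IsChannel Ψ) : IsChannel (Φ ∘ₗ Ψ) :=
  ⟨hΦ.1.comp hΨ.1, fun ρ => by rw [LinearMap.comp_apply, hΦ.2, hΨ.2]⟩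

lemma exists_embedding_channels [DecidableEq n] [DecidableEq m] [Nonempty n] (f : n ↪ m) :
    ∃ (Φ : SuperOp n m) (Ψ : SuperOp m n), IsChannel Φ ∧ IsChannel Ψ ∧
      Ψ ∘ₗ Φ = LinearMap.id := by
  have hV : (Matrix.of fun i x => if i = f x then (1 : ℂ) else 0)ᴴ *
      (Matrix.of fun i x => if i = f x then (1 : ℂ) else 0) = 1 := by
    ext x y
    simp [Matrix.mul_apply, Matrix.one_apply, f.injective.eq_iff, eq_comm]
  obtain ⟨Ψ, hΨ, h⟩ := exists_channel_comp_conjMap_eq_id hV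
  exact ⟨_, Ψ, isChannel_conjMap hV, hΨ, h⟩

omit [Fintype m] in
lemma eq_sum_smul_single [DecidableEq n] (Φ : SuperOp n m) (X : Matrix n n ℂ) :
    Φ X = ∑ x, ∑ y, X x y • Φ (Matrix.single x y 1) := by
  conv_lhs => rw [Matrix.matrix_eq_sum_single X]
  simp only [map_sum, ← map_smul, Matrix.smul_single, smul_eq_mul, mul_one]

end Channels

/-! ### One-way protocols as LOCC maps -/

section Composition

variable {a b a' b' a'' b'' : Type*} [Fintype a] [Fintype b] [Fintype a'] [Fintype b']
  [DecidableEq a] [DecidableEq b] [DecidableEq a'] [DecidableEq b']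

omit [Fintype a'] [Fintype b'] [DecidableEq a'] [DecidableEq b'] in
lemma tensorMap_kronecker (Φ : SuperOp a a') (Ψ : SuperOp b b') (X : Matrix a a ℂ)
    (Y : Matrix b b ℂ) : tensorMap Φ Ψ (X ⊗ₖ Y) = Φ X ⊗ₖ Ψ Y := by
  change (∑ x : a × b, ∑ y : a × b, (X ⊗ₖ Y) x y •
    (Φ (Matrix.single x.1 y.1 1) ⊗ₖ Ψ (Matrix.single x.2 y.2 1))) = _
  have hX : Φ X = ∑ x, ∑ y, X x y • Φ (Matrix.single x y 1) := eq_sum_smul_single Φ X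
  have hY : Ψ Y = ∑ x, ∑ y, Y x y • Ψ (Matrix.single x y 1) := eq_sum_smul_single Ψ Y
  rw [hX, hY]
  ext i j
  simp only [Matrix.kroneckerMap_apply, Matrix.sum_apply, Matrix.smul_apply, smul_eq_mul,
    Fintype.sum_prod_type, Finset.sum_mul_sum]
  refine Finset.sum_congr rfl fun x _ => Finset.sum_congr rfl fun y _ =>
    Finset.sum_congr rfl fun z _ => Finset.sum_congr rfl fun t _ => ?_
  ring

lemma tensorMap_comp (Φ : SuperOp a' a'') (Ψ : SuperOp b' b'') (Φ' : SuperOp a a')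
    (Ψ' : SuperOp b b') :
    tensorMap Φ Ψ ∘ₗ tensorMap Φ' Ψ' = tensorMap (Φ ∘ₗ Φ') (Ψ ∘ₗ Ψ') :=
  superOp_ext_single fun x y => by
    rw [LinearMap.comp_apply, tensorMap_single, tensorMap_kronecker, tensorMap_single]
    rfl

/-- The constant sequence works, each term being linked to the previous one by a trivial identity
round. -/
lemma isLOCCEndo_sum_of_isOneWayLocal {k : ℕ} {F : Fin k → SuperOp (a × b) (a × b)}
    (hF : IsOneWayLocal F) : IsLOCCEndo (∑ j, F j) := by
  refine ⟨fun _ => k, fun _ => F, fun _ => .one F F hF ⟨id, fun i => ?_⟩,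
    fun _ => ⟨fun _ => 1, fun _ _ => LinearMap.id, fun _ => .inl ⟨fun _ => LinearMap.id,
      fun _ => LinearMap.id, ⟨fun _ => isCompletelyPositive_id, fun ρ => by simp⟩,
      fun _ => isChannel_id, fun _ => tensorMap_id_id.symm⟩, Sigma.fst, fun i => ?_⟩,
    fun ρ => tendsto_const_nhds⟩
  · simp [Finset.filter_eq']
  · rw [Finset.sum_filter, Fintype.sum_sigma]
    simp

/-- One measurement by `A` followed by a channel at `B` is an LOCC map. -/
lemma isLOCC_sum_tensorMap [Nonempty a] [Nonempty b] [Nonempty a'] [Nonempty b'] {ι : Type*}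
    [Fintype ι] {E : ι → SuperOp a a'} {T : ι → SuperOp b b'} (hE : IsInstrument E)
    (hT : ∀ j, IsChannel (T j)) : IsLOCC (∑ j, tensorMap (E j) (T j)) := by
  -- LOCC acts on fixed working systems, so each party uses one large enough to contain both its
  -- input and its output.
  obtain ⟨f⟩ : Nonempty (a ↪ Fin (Fintype.card (a ⊕ a'))) :=
    ⟨Function.Embedding.inl.trans (Fintype.equivFin _).toEmbedding⟩
  obtain ⟨f'⟩ : Nonempty (a' ↪ Fin (Fintype.card (a ⊕ a'))) :=
    ⟨Function.Embedding.inr.trans (Fintype.equivFin _).toEmbedding⟩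
  obtain ⟨g⟩ : Nonempty (b ↪ Fin (Fintype.card (b ⊕ b'))) :=
    ⟨Function.Embedding.inl.trans (Fintype.equivFin _).toEmbedding⟩
  obtain ⟨g'⟩ : Nonempty (b' ↪ Fin (Fintype.card (b ⊕ b'))) :=
    ⟨Function.Embedding.inr.trans (Fintype.equivFin _).toEmbedding⟩
  obtain ⟨eA, dA, heA, hdA, hA⟩ := exists_embedding_channels f
  obtain ⟨eA', dA', heA', hdA', hA'⟩ := exists_embedding_channels f'
  obtain ⟨eB, dB, heB, hdB, hB⟩ := exists_embedding_channels g
  obtain ⟨eB', dB', heB', hdB', hB'⟩ := exists_embedding_channels g'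
  let e := (Fintype.equivFin ι).symm
  let F := fun i => tensorMap (eA' ∘ₗ E (e i) ∘ₗ dA) (eB' ∘ₗ T (e i) ∘ₗ dB)
  have hF : IsOneWayLocal F := by
    refine .inl ⟨_, _, ⟨fun i => heA'.1.comp ((hE.1 _).comp hdA.1), fun ρ => ?_⟩,
      fun i => heB'.comp ((hT _).comp hdB), fun i => rfl⟩
    simp only [LinearMap.sum_apply, LinearMap.comp_apply, Matrix.trace_sum, heA'.2 _]
    rw [Equiv.sum_comp e fun j => (E j (dA ρ)).trace, hE.2.sum_trace, hdA.2]
  refine ⟨_, _, eA, eB, dA', dB', _, heA, heB, hdA', hdB', isLOCCEndo_sum_of_isOneWayLocal hF, ?_⟩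
  have hj : ∀ i, tensorMap (E (e i)) (T (e i)) =
      tensorMap dA' dB' ∘ₗ F i ∘ₗ tensorMap eA eB := fun i => by
    rw [tensorMap_comp, tensorMap_comp]
    congr 1
    · rw [LinearMap.comp_assoc, LinearMap.comp_assoc, hA, ← LinearMap.comp_assoc, hA']
      rfl
    · rw [LinearMap.comp_assoc, LinearMap.comp_assoc, hB, ← LinearMap.comp_assoc, hB']
      rfl
  rw [← Equiv.sum_comp e fun j => tensorMap (E j) (T j)]
  simp only [hj]
  refine LinearMap.ext fun ρ => ?_
  simp only [LinearMap.sum_apply, LinearMap.comp_apply, map_sum]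

end Composition

/-! ### Merging by a measurement at `A` -/

section Measurement

variable {r a b : Type*} [Fintype r] [Fintype a] [Fintype b]
  [DecidableEq r] [DecidableEq a] [DecidableEq b]

omit [Fintype r] [Fintype a] [Fintype b] [DecidableEq r] [DecidableEq a] [DecidableEq b] in
lemma pureState_apply {n : Type*} (v : n → ℂ) (x y : n) :
    pureState v x y = v x * star (v y) := rfl

lemma tensorMap_id_krausMap_pureState {b' : Type*} [Fintype b'] {k : ℕ}
    (V : Fin k → Matrix b' b ℂ) (v : r × b → ℂ) :
    tensorMap (LinearMap.id : SuperOp r r) (krausMap V) (pureState v) =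
      ∑ i, pureState (((1 : Matrix r r ℂ) ⊗ₖ V i) *ᵥ v) := by
  have hid : (LinearMap.id : SuperOp r r) = krausMap fun _ : Fin 1 => 1 :=
    LinearMap.ext fun ρ => by simp [krausMap_apply]
  rw [hid, tensorMap_krausMap, Fintype.sum_prod_type]
  simp [mul_pureState_mul]

/-- The unnormalized state `⟨w|φ⟩` on `R ⊗ B` after a measurement at `A`. -/
def postMeasurement (w : a → ℂ) (φ : r × (a × b) → ℂ) : r × b → ℂ :=
  fun p => ∑ x, star (w x) * φ (p.1, x, p.2)

lemma tensorMap_id_bra_pureState {b' : Type*} [Fintype b'] (w : a → ℂ)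
    {T : SuperOp b b'} (hT : IsCompletelyPositive T) (φ : r × (a × b) → ℂ)
    (p q : r × (Fin 1 × b')) :
    tensorMap (LinearMap.id : SuperOp r r)
      (tensorMap (conjMap (Matrix.of fun (_ : Fin 1) x => star (w x))) T) (pureState φ) p q =
    tensorMap (LinearMap.id : SuperOp r r) T (pureState (postMeasurement w φ))
      (p.1, p.2.2) (q.1, q.2.2) := by
  obtain ⟨k, V, rfl⟩ := hT
  have h1 : tensorMap (conjMap (Matrix.of fun (_ : Fin 1) x => star (w x))) (krausMap V) =
      krausMap fun i => (Matrix.of fun (_ : Fin 1) x => star (w x)) ⊗ₖ V i :=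
    LinearMap.ext fun ρ => by
      rw [conjMap, tensorMap_krausMap, krausMap_apply, Fintype.sum_prod_type]
      simp
  have h2 : ∀ i (p : r × (Fin 1 × b')), (((1 : Matrix r r ℂ) ⊗ₖ
      ((Matrix.of fun (_ : Fin 1) x => star (w x)) ⊗ₖ V i)) *ᵥ φ) p =
      (((1 : Matrix r r ℂ) ⊗ₖ V i) *ᵥ postMeasurement w φ) (p.1, p.2.2) := by
    intro i p
    simp only [mulVec, dotProduct, Fintype.sum_prod_type, Matrix.kroneckerMap_apply,
      Matrix.of_apply, postMeasurement, Finset.mul_sum]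
    refine Finset.sum_congr rfl fun x _ => ?_
    rw [Finset.sum_comm]
    refine Finset.sum_congr rfl fun y _ => Finset.sum_congr rfl fun z _ => ?_
    ring
  rw [h1, tensorMap_id_krausMap_pureState, tensorMap_id_krausMap_pureState]
  simp only [Matrix.sum_apply, pureState_apply, h2]

/-- Merging by a rank-one measurement at `A` and channels at `B` which depend on the outcome. -/
lemma merging_of_measurement [Nonempty a] [Nonempty b] {ψ : EuclideanSpace ℂ (r × a × b)} {K : ℕ}
    (hK : 0 < K) {ι : Type*} [Fintype ι] (w : ι → a × Fin K → ℂ)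
    (hw : ∀ x y, ∑ j, w j x * star (w j y) = if x = y then 1 else 0)
    (T : ι → SuperOp (b × Fin K) ((a × b) × Fin 1)) (hT : ∀ j, IsChannel (T j)) (p : ι → ℂ)
    (hp : ∑ j, p j = 1)
    (h : ∀ j, tensorMap (LinearMap.id : SuperOp r r) (T j)
      (pureState (postMeasurement (w j) (mergingInput ψ K))) =
        p j • pureState fun q => ψ (q.1, q.2.1)) :
    NonCatalyticExactStateMerging ψ K := by
  have : Nonempty (Fin K) := ⟨⟨0, hK⟩⟩
  -- The target system of `A` is one-dimensional, so the bra `⟨w j|` is itself a Kraus operator, and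
  -- `hw` says that these are complete.
  let E : ι → SuperOp (a × Fin K) (Fin 1) := fun j =>
    conjMap (Matrix.of fun (_ : Fin 1) x => star (w j x))
  have hE : IsInstrument E := by
    refine ⟨fun j => ⟨_, _, rfl⟩, isTracePreserving_of_sum_eq_one
      (V := fun j => Matrix.of fun (_ : Fin 1) x => star (w j x))
      (fun ρ => by simp only [E, LinearMap.sum_apply, conjMap_apply]) ?_⟩
    ext x y
    rw [Matrix.sum_apply, Matrix.one_apply, ← hw x y]
    simp [Matrix.mul_apply]
  refine ⟨_, isLOCC_sum_tensorMap hE hT, ?_⟩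
  have hadd : ∀ ρ, tensorMap (LinearMap.id : SuperOp r r) (∑ j, tensorMap (E j) (T j)) ρ =
      ∑ j, tensorMap (LinearMap.id : SuperOp r r) (tensorMap (E j) (T j)) ρ := by
    intro ρ
    rw [← LinearMap.sum_apply]
    congr 1
    refine superOp_ext_single fun x y => ?_
    rw [tensorMap_single, LinearMap.sum_apply, LinearMap.sum_apply]
    simp only [tensorMap_single]
    ext i j
    simp only [Matrix.kroneckerMap_apply, Matrix.sum_apply, Finset.mul_sum]
  rw [hadd]
  ext ⟨i, z, q⟩ ⟨i', z', q'⟩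
  rw [Matrix.sum_apply]
  simp only [E, tensorMap_id_bra_pureState _ (hT _).1, h, Matrix.smul_apply, smul_eq_mul]
  rw [← Finset.sum_mul, hp, one_mul]
  obtain ⟨q, t⟩ := q
  obtain ⟨q', t'⟩ := q'
  fin_cases z
  fin_cases z'
  fin_cases t
  fin_cases t'
  simp only [pureState_apply]
  exact congrArg₂ (fun u v => u * star v) (mergingOutput_one_apply ψ i q).symm
    (mergingOutput_one_apply ψ i' q').symm

end Measurement

/-! ### Teleportation for `K ≥ 2` -/

section Teleportation

variable {r b b' : Type*} [Fintype r] [Fintype b] [Fintype b'] [DecidableEq r] [DecidableEq b]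
  [DecidableEq b']

omit [Fintype r] [Fintype b] [DecidableEq r] [DecidableEq b] in
lemma pureState_smul {n : Type*} (c : ℂ) (v : n → ℂ) :
    pureState (c • v) = ((‖c‖ ^ 2 : ℝ) : ℂ) • pureState v := by
  ext x y
  simp only [pureState_apply, Pi.smul_apply, Matrix.smul_apply, smul_eq_mul, star_mul',
    Complex.ofReal_pow, ← Complex.mul_conj', RCLike.star_def]
  ring

omit [DecidableEq b'] in
lemma tensorMap_id_conjMap_pureState (V : Matrix b' b ℂ) (v : r × b → ℂ) :
    tensorMap (LinearMap.id : SuperOp r r) (conjMap V) (pureState v) =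
      pureState (((1 : Matrix r r ℂ) ⊗ₖ V) *ᵥ v) := by
  rw [conjMap, tensorMap_id_krausMap_pureState]
  simp

lemma tensorMap_id_pureState_of_comp_conjMap {V : Matrix b' b ℂ} {Φ : SuperOp b' b}
    (h : Φ ∘ₗ conjMap V = LinearMap.id) (v : r × b → ℂ) :
    tensorMap (LinearMap.id : SuperOp r r) Φ (pureState (((1 : Matrix r r ℂ) ⊗ₖ V) *ᵥ v)) =
      pureState v := by
  rw [← tensorMap_id_conjMap_pureState, ← LinearMap.comp_apply, tensorMap_comp, h]
  simp [tensorMap_id_id]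

/-- The shift by `a`. -/
def bitShift {n : ℕ} (a : Fin 2) (x : Fin (n + 2)) : Fin (n + 2) :=
  x + if a = 0 then 0 else 1

/-- The phase `(-1)^(s a)`. -/
def bitPhase (s a : Fin 2) : ℂ := if s = 1 ∧ a = 1 then -1 else 1

/-- The Bell-type measurement vectors of the teleportation protocol. -/
def bellVector {n : ℕ} (j : Fin (n + 2) × Fin 2) (q : Fin 2 × Fin (n + 2)) : ℂ :=
  if q.2 = bitShift q.1 j.1 then bitPhase j.2 q.1 * ((√2)⁻¹ : ℝ) else 0

/-- The isometry from the teleported systems to the state held by `B` after the measurement. -/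
def bellEncoding (b : Type*) [DecidableEq b] {n : ℕ} (j : Fin (n + 2) × Fin 2) :
    Matrix (b × Fin (n + 2)) ((Fin 2 × b) × Fin 1) ℂ :=
  Matrix.of fun p q =>
    if p = (q.1.2, bitShift q.1.1 j.1) then bitPhase j.2 q.1.1 else 0

lemma inv_sqrt_two_mul_self : (((√2)⁻¹ : ℝ) : ℂ) * (((√2)⁻¹ : ℝ) : ℂ) = 1 / 2 := by
  rw [← Complex.ofReal_mul, ← mul_inv, Real.mul_self_sqrt (by norm_num)]
  norm_num

lemma star_bitPhase (s a : Fin 2) : star (bitPhase s a) = bitPhase s a := by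
  unfold bitPhase
  split_ifs <;> simp

lemma sum_bitPhase_mul_bitPhase (a a' : Fin 2) :
    ∑ s, bitPhase s a * bitPhase s a' = if a = a' then 2 else 0 := by
  fin_cases a <;> fin_cases a' <;> norm_num [bitPhase]

lemma bitPhase_mul_self (s a : Fin 2) : bitPhase s a * bitPhase s a = 1 := by
  unfold bitPhase
  split_ifs <;> simp

/-- This is where `K ≥ 2` matters: `0` and `1` are distinct shifts of `Fin (n + 2)`. -/
lemma bitShift_inj {n : ℕ} (a a' : Fin 2) (x : Fin (n + 2)) :
    bitShift a x = bitShift a' x ↔ a = a' := by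
  unfold bitShift
  fin_cases a <;> fin_cases a' <;> simp

lemma bellVector_completeness {n : ℕ} (p q : Fin 2 × Fin (n + 2)) :
    ∑ j, bellVector j p * star (bellVector j q) = if p = q then 1 else 0 := by
  obtain ⟨a, l⟩ := p
  obtain ⟨a', l'⟩ := q
  have hh := inv_sqrt_two_mul_self
  -- For given `(a, l)` only the shift `x` with `l = bitShift a x` contributes; summing the signs
  -- over `s` then forces `a = a'`.
  have h1 : ∀ x : Fin (n + 2), ∑ s, bellVector (x, s) (a, l) * star (bellVector (x, s) (a', l')) =
      if x = l - (if a = 0 then 0 else 1) then (if (a, l) = (a', l') then 1 else 0) else 0 := by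
    intro x
    have hx : x = l - (if a = 0 then 0 else 1) ↔ l = bitShift a x := by
      rw [eq_sub_iff_add_eq, eq_comm, bitShift]
    simp only [hx, bellVector]
    by_cases hl : l = bitShift a x
    · by_cases hl' : l' = bitShift a' x
      · simp only [if_pos hl, if_pos hl', star_mul', star_bitPhase]
        have h2 : (a, l) = (a', l') ↔ a = a' := by
          rw [hl, hl', Prod.mk.injEq, bitShift_inj, and_self]
        have h3 := sum_bitPhase_mul_bitPhase a a'
        have h4 : star (((√2)⁻¹ : ℝ) : ℂ) = (((√2)⁻¹ : ℝ) : ℂ) := Complex.conj_ofReal _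
        simp only [h2, h4, mul_mul_mul_comm _ (((√2)⁻¹ : ℝ) : ℂ), hh, ← Finset.sum_mul, h3]
        split_ifs <;> norm_num
      · have h2 : (a, l) ≠ (a', l') := fun h => by
          rw [Prod.mk.injEq] at h
          exact hl' (h.2 ▸ h.1 ▸ hl)
        simp [hl', h2]
    · simp [hl]
  rw [Fintype.sum_prod_type]
  simp only [h1, Finset.sum_ite_eq', Finset.mem_univ, if_true]

lemma bellEncoding_isometry {n : ℕ} (j : Fin (n + 2) × Fin 2) :
    (bellEncoding b j)ᴴ * bellEncoding b j = 1 := by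
  ext ⟨⟨a, k⟩, z⟩ ⟨⟨a', k'⟩, z'⟩
  fin_cases z
  fin_cases z'
  simp only [Matrix.mul_apply, bellEncoding, Matrix.of_apply, Matrix.conjTranspose_apply,
    Matrix.one_apply]
  rw [Finset.sum_eq_single (k, bitShift a j.1) (fun p _ hp => by simp [hp]) (by simp)]
  simp only [if_true, star_bitPhase, Prod.mk.injEq, bitShift_inj, and_true]
  by_cases h : a = a' ∧ k = k'
  · rw [if_pos ⟨h.2, h.1⟩, if_pos h, h.1, bitPhase_mul_self]
  · rw [if_neg fun h' => h ⟨h'.2, h'.1⟩, if_neg h, mul_zero]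

/-- Merging by teleportation. -/
lemma merging_by_teleportation [Nonempty b] (ψ : EuclideanSpace ℂ (r × Fin 2 × b)) (n : ℕ) :
    NonCatalyticExactStateMerging ψ (n + 2) := by
  choose Φ hΦ hΦ' using fun j => exists_channel_comp_conjMap_eq_id
    (bellEncoding_isometry (b := b) (n := n) j)
  -- All `2K` outcomes are equally likely, with probability `(1/√2 · 1/√K)² = 1/(2K)`.
  refine merging_of_measurement (by omega) bellVector bellVector_completeness Φ hΦ
    (fun _ => ((1 / (2 * (n + 2)) : ℝ) : ℂ)) ?_ fun j => ?_
  · simp only [Finset.sum_const, Finset.card_univ, Fintype.card_prod, Fintype.card_fin]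
    have : (n + 2 : ℂ) ≠ 0 := by exact_mod_cast (by omega : n + 2 ≠ 0)
    push_cast
    rw [nsmul_eq_mul]
    push_cast
    field_simp
  · have hη : postMeasurement (bellVector j) (mergingInput ψ (n + 2)) =
        (((√2)⁻¹ * (1 / √((n + 2 : ℕ) : ℝ)) : ℝ) : ℂ) •
          (((1 : Matrix r r ℂ) ⊗ₖ bellEncoding b j) *ᵥ fun q => ψ (q.1, q.2.1)) := by
      ext ⟨i, k, l⟩
      simp only [postMeasurement, mergingInput, maxEntangled, bellVector, bellEncoding,
        Pi.smul_apply, mulVec, dotProduct, Fintype.sum_prod_type, Matrix.kroneckerMap_apply,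
        Matrix.of_apply, Matrix.one_apply, smul_eq_mul, Prod.mk.injEq]
      simp only [Fin.sum_univ_two, Finset.univ_unique, Finset.sum_singleton, ite_and, mul_ite,
        ite_mul, one_mul, zero_mul, mul_zero, Finset.sum_ite_eq, Finset.sum_ite_eq',
        Finset.mem_univ, if_true, Finset.sum_add_distrib, apply_ite star, star_zero, star_mul',
        star_bitPhase, mul_add]
      have h4 : star (((√2)⁻¹ : ℝ) : ℂ) = (((√2)⁻¹ : ℝ) : ℂ) := Complex.conj_ofReal _
      simp only [h4, Complex.ofReal_mul]
      by_cases l0 : l = bitShift 0 j.1 <;> by_cases l1 : l = bitShift 1 j.1 <;>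
        simp only [l0, l1, bitShift_inj, zero_ne_one, one_ne_zero, if_true, if_false,
          Finset.sum_ite_eq, Finset.mem_univ,
          Finset.sum_const_zero] <;> ring
    rw [hη, pureState_smul, map_smul, tensorMap_id_pureState_of_comp_conjMap (hΦ' j)]
    congr 2
    rw [Complex.norm_real, Real.norm_eq_abs, sq_abs, mul_pow, inv_pow, div_pow,
      Real.sq_sqrt (by norm_num), Real.sq_sqrt (by positivity)]
    push_cast
    field_simp

end Teleportation

/-! ### Unital qubit channels with two Kraus operators -/

section UnitalMeasurement

open scoped ComplexOrder

/-- The scalar is the squared norm of a row, hence real and nonnegative; for square matrices a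
one-sided inverse is two-sided. -/
lemma exists_real_of_mul_conjTranspose {n : Type*} [Fintype n] [DecidableEq n] [Nonempty n]
    {N : Matrix n n ℂ} {d : ℂ} (h : N * Nᴴ = d • (1 : Matrix n n ℂ)) :
    ∃ c : ℝ, 0 ≤ c ∧ N * Nᴴ = (c : ℂ) • (1 : Matrix n n ℂ) ∧
      Nᴴ * N = (c : ℂ) • (1 : Matrix n n ℂ) := by
  obtain ⟨i⟩ := ‹Nonempty n›
  have hd : d = ((∑ j, ‖N i j‖ ^ 2 : ℝ) : ℂ) := by
    have := congrFun (congrFun h i) i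
    simp only [Matrix.mul_apply, Matrix.conjTranspose_apply, RCLike.star_def, Complex.mul_conj',
      Matrix.smul_apply, Matrix.one_apply_eq, smul_eq_mul, mul_one] at this
    rw [← this]
    push_cast
    rfl
  refine ⟨_, Finset.sum_nonneg fun j _ => by positivity, hd ▸ h, ?_⟩
  rw [← hd]
  by_cases h0 : d = 0
  · rw [h0, zero_smul] at h ⊢
    rw [Matrix.self_mul_conjTranspose_eq_zero] at h
    simp [h]
  · have h1 : N * (d⁻¹ • Nᴴ) = 1 := by
      rw [Matrix.mul_smul, h, smul_smul, inv_mul_cancel₀ h0, one_smul]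
    rw [mul_eq_one_comm, Matrix.smul_mul] at h1
    rw [← h1, smul_smul, mul_inv_cancel₀ h0, one_smul]

/-- A matrix commuting with a non-scalar `2 × 2` matrix is a polynomial in it. -/
lemma exists_eq_smul_add_smul_of_commute {H X : Matrix (Fin 2) (Fin 2) ℂ} (h : H * X = X * H)
    (hH : ∀ d : ℂ, H ≠ d • (1 : Matrix (Fin 2) (Fin 2) ℂ)) :
    ∃ p q : ℂ, X = p • (1 : Matrix (Fin 2) (Fin 2) ℂ) + q • H := by
  have e00 := congrFun (congrFun h 0) 0
  have e01 := congrFun (congrFun h 0) 1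
  have e10 := congrFun (congrFun h 1) 0
  simp only [Matrix.mul_apply, Fin.sum_univ_two] at e00 e01 e10
  -- As `H` is not scalar, one of `H 0 1`, `H 1 0`, `H 0 0 - H 1 1` is nonzero. Dividing by it gives
  -- `q`, and `p` is fitted to the entry `(0, 0)`.
  by_cases h01 : H 0 1 = 0
  · by_cases h10 : H 1 0 = 0
    · have hne : H 0 0 - H 1 1 ≠ 0 := fun h0 => hH (H 0 0) <| by
        ext i j
        fin_cases i <;> fin_cases j <;> simp [h01, h10, sub_eq_zero.1 h0]
      rw [h01] at e01
      rw [h10] at e10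
      have x01 : X 0 1 = 0 := mul_left_cancel₀ hne (by linear_combination e01)
      have x10 : X 1 0 = 0 := mul_left_cancel₀ hne (by linear_combination -e10)
      refine ⟨X 0 0 - (X 0 0 - X 1 1) / (H 0 0 - H 1 1) * H 0 0,
        (X 0 0 - X 1 1) / (H 0 0 - H 1 1), ?_⟩
      ext i j
      fin_cases i <;> fin_cases j <;> simp [h01, h10, x01, x10]
      field_simp
      ring
    · refine ⟨X 0 0 - X 1 0 / H 1 0 * H 0 0, X 1 0 / H 1 0, ?_⟩
      ext i j
      fin_cases i <;> fin_cases j <;> simp [h10]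
      · field_simp
        linear_combination -e00
      · field_simp
        linear_combination -e10
  · refine ⟨X 0 0 - X 0 1 / H 0 1 * H 0 0, X 0 1 / H 0 1, ?_⟩
    ext i j
    fin_cases i <;> fin_cases j <;> simp [h01]
    · field_simp
      linear_combination e00
    · field_simp
      linear_combination e01

lemma exists_phase_mul_add_conj_eq_zero (q : ℂ) :
    ∃ z : ℂ, z * star z = 1 ∧ z * q + star (z * q) = 0 := by
  by_cases hq : q = 0
  · exact ⟨1, by simp, by simp [hq]⟩
  · have hn : (‖q‖ : ℂ) ≠ 0 := by simpa using hq
    have h1 := Complex.mul_conj' q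
    -- This phase makes `z * q = i‖q‖` purely imaginary.
    refine ⟨Complex.I * star q / ‖q‖, ?_, ?_⟩
    · simp only [RCLike.star_def, map_div₀, map_mul, Complex.conj_I, Complex.conj_conj,
        Complex.conj_ofReal]
      field_simp
      rw [Complex.I_sq]
      linear_combination h1
    · simp only [RCLike.star_def, map_div₀, map_mul, Complex.conj_I, Complex.conj_conj,
        Complex.conj_ofReal]
      field_simp
      ring

/-- A pair of Kraus operators of a unital qubit channel (up to scaling) is, up to a unitary mixing,
a pair of multiples of unitaries. -/
lemma exists_mixing_to_unitaries {M : Fin 2 → Matrix (Fin 2) (Fin 2) ℂ}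
    (h1 : ∑ a, M a * (M a)ᴴ = (1 / 2 : ℂ) • (1 : Matrix (Fin 2) (Fin 2) ℂ))
    (h2 : ∑ a, (M a)ᴴ * M a = (1 / 2 : ℂ) • (1 : Matrix (Fin 2) (Fin 2) ℂ)) :
    ∃ u : Fin 2 → Fin 2 → ℂ, (∀ x y, ∑ j, u j x * star (u j y) = if x = y then 1 else 0) ∧
      ∃ c : Fin 2 → ℝ, ∑ j, c j = 1 / 2 ∧ ∀ j, 0 ≤ c j ∧
        (∑ a, star (u j a) • M a) * (∑ a, star (u j a) • M a)ᴴ =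
          (c j : ℂ) • (1 : Matrix (Fin 2) (Fin 2) ℂ) ∧
        (∑ a, star (u j a) • M a)ᴴ * (∑ a, star (u j a) • M a) =
          (c j : ℂ) • (1 : Matrix (Fin 2) (Fin 2) ℂ) := by
  -- Only the first mixture has to be treated: the two products sum to a scalar matrix, so the
  -- second is then scalar as well.
  suffices h : ∃ u : Fin 2 → Fin 2 → ℂ,
      (∀ x y, ∑ j, u j x * star (u j y) = if x = y then 1 else 0) ∧
      ∑ j, (∑ a, star (u j a) • M a) * (∑ a, star (u j a) • M a)ᴴ =
        (1 / 2 : ℂ) • (1 : Matrix (Fin 2) (Fin 2) ℂ) ∧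
      ∃ d : ℂ, (∑ a, star (u 0 a) • M a) * (∑ a, star (u 0 a) • M a)ᴴ =
        d • (1 : Matrix (Fin 2) (Fin 2) ℂ) by
    obtain ⟨u, hu, hsum, d, hd⟩ := h
    refine ⟨u, hu, ?_⟩
    have hd' : ∀ j, ∃ d : ℂ, (∑ a, star (u j a) • M a) * (∑ a, star (u j a) • M a)ᴴ =
        d • (1 : Matrix (Fin 2) (Fin 2) ℂ) := by
      rw [Fin.forall_fin_two]
      refine ⟨⟨d, hd⟩, 1 / 2 - d, ?_⟩
      rw [Fin.sum_univ_two (f := fun j => (∑ a, star (u j a) • M a) *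
        (∑ a, star (u j a) • M a)ᴴ), hd] at hsum
      rw [sub_smul, ← hsum, add_sub_cancel_left]
    choose d hd using hd'
    choose c hc0 hc1 hc2 using fun j => exists_real_of_mul_conjTranspose (hd j)
    refine ⟨c, ?_, fun j => ⟨hc0 j, hc1 j, hc2 j⟩⟩
    simp only [hc1] at hsum
    have := congrFun (congrFun hsum 0) 0
    simp only [Matrix.sum_apply, Matrix.smul_apply, Matrix.one_apply_eq, smul_eq_mul,
      mul_one] at this
    apply Complex.ofReal_injective
    push_cast
    exact this
  by_cases hH : ∃ d : ℂ, M 0 * (M 0)ᴴ = d • (1 : Matrix (Fin 2) (Fin 2) ℂ)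
  · refine ⟨fun j a => if j = a then 1 else 0, ?_, ?_, ?_⟩
    · simp [eq_comm]
    · simpa using h1
    · simpa using hH
  push Not at hH
  have hMM : M 1 * (M 1)ᴴ = (1 / 2 : ℂ) • (1 : Matrix (Fin 2) (Fin 2) ℂ) - M 0 * (M 0)ᴴ := by
    rw [← h1, Fin.sum_univ_two, add_sub_cancel_left]
  have hMM' : (M 1)ᴴ * M 1 = (1 / 2 : ℂ) • (1 : Matrix (Fin 2) (Fin 2) ℂ) - (M 0)ᴴ * M 0 := by
    rw [← h2, Fin.sum_univ_two, add_sub_cancel_left]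
  -- Trading `(M 0)ᴴ * M 0` for `1/2 - (M 1)ᴴ * M 1`, and then `M 1 * (M 1)ᴴ` for `1/2 - M 0 * (M
  -- 0)ᴴ`, shows that `H = M 0 * (M 0)ᴴ` commutes with `X = M 0 * (M 1)ᴴ`. Thus `X = p + q H`.
  have hcomm : M 0 * (M 0)ᴴ * (M 0 * (M 1)ᴴ) = M 0 * (M 1)ᴴ * (M 0 * (M 0)ᴴ) := by
    have e1 : M 0 * (M 0)ᴴ * (M 0 * (M 1)ᴴ) = M 0 * ((M 0)ᴴ * M 0) * (M 1)ᴴ := by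
      simp only [Matrix.mul_assoc]
    have e2 : (M 0)ᴴ * M 0 = (1 / 2 : ℂ) • (1 : Matrix (Fin 2) (Fin 2) ℂ) - (M 1)ᴴ * M 1 := by
      rw [hMM', sub_sub_cancel]
    have e3 : M 0 * (M 0)ᴴ = (1 / 2 : ℂ) • (1 : Matrix (Fin 2) (Fin 2) ℂ) - M 1 * (M 1)ᴴ := by
      rw [hMM, sub_sub_cancel]
    rw [e1, e2, e3]
    simp only [Matrix.mul_sub, Matrix.sub_mul, Matrix.mul_smul, Matrix.smul_mul, Matrix.mul_one,
      Matrix.mul_assoc]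
  obtain ⟨p, q, hpq⟩ := exists_eq_smul_add_smul_of_commute hcomm hH
  obtain ⟨z, hz, hzq⟩ := exists_phase_mul_add_conj_eq_zero q
  have hs := inv_sqrt_two_mul_self
  set s : ℂ := (((√2)⁻¹ : ℝ) : ℂ) with hsdef
  have hss : star s = s := by simp [hsdef]
  have hX' : M 1 * (M 0)ᴴ = star p • (1 : Matrix (Fin 2) (Fin 2) ℂ) + star q • (M 0 * (M 0)ᴴ) := by
    have := congrArg Matrix.conjTranspose hpq
    simpa using this
  have expand : ∀ t : ℂ, t * star t = 1 → (star s • M 0 + star (s * t) • M 1) *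
      (star s • M 0 + star (s * t) • M 1)ᴴ =
      (1 / 2 : ℂ) • ((1 / 2 : ℂ) • (1 : Matrix (Fin 2) (Fin 2) ℂ) +
        t • (M 0 * (M 1)ᴴ) + star t • (M 1 * (M 0)ᴴ)) := by
    intro t ht
    simp only [star_mul', hss, Matrix.conjTranspose_add, Matrix.conjTranspose_smul, Matrix.mul_add,
      Matrix.add_mul, Matrix.smul_mul, Matrix.mul_smul, star_star, hMM]
    ext i j
    simp only [Matrix.add_apply, Matrix.sub_apply, Matrix.smul_apply, smul_eq_mul]
    linear_combination ((M 0 * (M 0)ᴴ) i j + star t * (M 1 * (M 0)ᴴ) i j +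
      t * (M 0 * (M 1)ᴴ) i j + t * star t * (1 / 2 * (1 : Matrix (Fin 2) (Fin 2) ℂ) i j -
        (M 0 * (M 0)ᴴ) i j)) * hs +
      1 / 2 * (1 / 2 * (1 : Matrix (Fin 2) (Fin 2) ℂ) i j - (M 0 * (M 0)ᴴ) i j) * ht
  -- In `z X + (z X)ᴴ` the coefficient of `H` is `z q + star (z q) = 0`, so this unitary mixing
  -- leaves a scalar; the opposite sign in the second row cancels the cross terms in the sum.
  refine ⟨![![s, s * z], ![s, s * -z]], ?_, ?_, ?_⟩
  · rw [RCLike.star_def] at hss hz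
    intro x y
    fin_cases x <;> fin_cases y <;> simp [Fin.sum_univ_two, hss]
    · linear_combination 2 * hs
    · linear_combination 2 * z * (starRingEnd ℂ) z * hs + hz
  · simp only [Fin.sum_univ_two, Matrix.cons_val_zero, Matrix.cons_val_one]
    rw [expand z hz, expand (-z) (by simpa using hz), ← smul_add]
    simp only [star_neg, neg_smul]
    rw [show ∀ A B C : Matrix (Fin 2) (Fin 2) ℂ, A + B + C + (A + -B + -C) = (2 : ℂ) • A from
      fun A B C => by rw [two_smul]; abel, smul_smul, smul_smul]
    norm_num
  · refine ⟨1 / 2 * (1 / 2 + (z * p + star (z * p))), ?_⟩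
    simp only [Fin.sum_univ_two, Matrix.cons_val_zero, Matrix.cons_val_one]
    rw [expand z hz, hpq, hX']
    have : star z * star q = - (z * q) := by
      rw [← star_mul']; linear_combination hzq
    simp only [smul_add, smul_smul, this, star_mul']
    module

end UnitalMeasurement

/-! ### Merging without entanglement when `ψ^B` is maximally mixed -/

section ZeroEntanglement

variable {r b q : Type*} [Fintype r] [Fintype b] [Fintype q] [DecidableEq r] [DecidableEq b]

/-- Two purifications of the same multiple of the identity are related by an isometry. -/
lemma exists_isometry_of_purifications {N : Matrix r b ℂ} {Ψ : Matrix r q ℂ} {c : ℝ} (hc : 0 ≤ c)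
    (hN : N * Nᴴ = (c : ℂ) • (1 : Matrix r r ℂ)) (hN' : Nᴴ * N = (c : ℂ) • (1 : Matrix b b ℂ))
    (hΨ : Ψ * Ψᴴ = (1 / 2 : ℂ) • (1 : Matrix r r ℂ)) {Y₀ : Matrix b q ℂ} (hY₀ : Y₀ * Y₀ᴴ = 1) :
    ∃ Y : Matrix b q ℂ, Y * Yᴴ = 1 ∧ N * Y = ((√(2 * c) : ℝ) : ℂ) • Ψ := by
  rcases hc.eq_or_lt with rfl | hc
  -- An outcome of probability zero: any matrix with orthonormal rows will do.
  · refine ⟨Y₀, hY₀, ?_⟩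
    have h0 : N = 0 := by
      open scoped ComplexOrder in
      rw [← Matrix.self_mul_conjTranspose_eq_zero, hN]
      simp
    simp [h0]
  · have hk : (((√(2 / c) : ℝ) : ℂ)) * ((√(2 / c) : ℝ) : ℂ) * c = 2 := by
      rw [← Complex.ofReal_mul, Real.mul_self_sqrt (by positivity), ← Complex.ofReal_mul,
        div_mul_cancel₀ _ hc.ne']
      norm_num
    have hk' : √(2 * c) = √(2 / c) * c := by
      rw [show 2 * c = 2 / c * c ^ 2 by field_simp, Real.sqrt_mul (by positivity),
        Real.sqrt_sq hc.le]
    -- `N` is `√c` times a unitary, so `Y` must be proportional to `Nᴴ * Ψ`; the factor normalizes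
    -- `Nᴴ * (1/2) * N = c/2` to `1`.
    refine ⟨((√(2 / c) : ℝ) : ℂ) • (Nᴴ * Ψ), ?_, ?_⟩
    · rw [Matrix.conjTranspose_smul, Matrix.conjTranspose_mul, Matrix.conjTranspose_conjTranspose,
        Matrix.smul_mul, Matrix.mul_smul, Matrix.mul_assoc, ← Matrix.mul_assoc Ψ, hΨ,
        Matrix.smul_mul, Matrix.one_mul, Matrix.mul_smul, hN', smul_smul, smul_smul, smul_smul,
        RCLike.star_def, Complex.conj_ofReal]
      rw [show ((√(2 / c) : ℝ) : ℂ) * ((√(2 / c) : ℝ) : ℂ) * (1 / 2) * c = 1 by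
        linear_combination 1 / 2 * hk, one_smul]
    · rw [Matrix.mul_smul, ← Matrix.mul_assoc, hN, Matrix.smul_mul, Matrix.one_mul, smul_smul, hk',
        Complex.ofReal_mul]

/-- If `ψ^R` and `ψ^B` are maximally mixed, merging needs no entanglement. -/
lemma merging_one_of_reducedB_eq {ψ : EuclideanSpace ℂ (Fin 2 × Fin 2 × Fin 2)}
    (hR : reducedR ψ = (1 / 2 : ℂ) • (1 : Matrix (Fin 2) (Fin 2) ℂ))
    (hB : reducedB ψ = (1 / 2 : ℂ) • (1 : Matrix (Fin 2) (Fin 2) ℂ)) :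
    NonCatalyticExactStateMerging ψ 1 := by
  let M : Fin 2 → Matrix (Fin 2) (Fin 2) ℂ := fun a => Matrix.of fun i j => ψ (i, a, j)
  let Ψ : Matrix (Fin 2) (Fin 2 × Fin 2) ℂ := Matrix.of fun i q => ψ (i, q)
  have hΨ : Ψ * Ψᴴ = (1 / 2 : ℂ) • (1 : Matrix (Fin 2) (Fin 2) ℂ) := by
    rw [← hR]
    ext i i'
    simp [Ψ, Matrix.mul_apply, reducedR, traceSnd, pureState_apply]
  have h1 : ∑ a, M a * (M a)ᴴ = (1 / 2 : ℂ) • (1 : Matrix (Fin 2) (Fin 2) ℂ) := by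
    rw [← hΨ]
    ext i i'
    simp [M, Ψ, Matrix.mul_apply, Matrix.sum_apply, Fintype.sum_prod_type]
  have h2 : ∑ a, (M a)ᴴ * M a = (1 / 2 : ℂ) • (1 : Matrix (Fin 2) (Fin 2) ℂ) := by
    -- The sum of the `(M a)ᴴ * M a` is the transpose of `ψ^B`.
    rw [← Matrix.transpose_one, ← Matrix.transpose_smul, ← hB]
    ext j j'
    simp only [M, Matrix.mul_apply, Matrix.sum_apply, Matrix.conjTranspose_apply, Matrix.of_apply,
      Matrix.transpose_apply, reducedB_apply, Fintype.sum_prod_type]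
    rw [Finset.sum_comm]
    exact Finset.sum_congr rfl fun i _ => Finset.sum_congr rfl fun a _ => mul_comm _ _
  obtain ⟨u, hu, c, hc, hN⟩ := exists_mixing_to_unitaries h1 h2
  have hY₀ : (Matrix.of fun (j : Fin 2) (q : Fin 2 × Fin 2) => if q = (0, j) then (1 : ℂ) else 0) *
      (Matrix.of fun (j : Fin 2) (q : Fin 2 × Fin 2) => if q = (0, j) then (1 : ℂ) else 0)ᴴ =
        1 := by
    ext j j'
    simp [Matrix.mul_apply, Matrix.one_apply, eq_comm]
  choose Y hY hNY using fun j =>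
    exists_isometry_of_purifications (hN j).1 (hN j).2.1 (hN j).2.2 hΨ hY₀
  -- `B` applies the transpose of `Y j`, since `Y j` multiplies the `R × B` coefficient matrix from
  -- the right.
  let W : Fin 2 → Matrix ((Fin 2 × Fin 2) × Fin 1) (Fin 2 × Fin 1) ℂ := fun j =>
    Matrix.of fun q x => Y j x.1 q.1
  have hW : ∀ j, (W j)ᴴ * W j = 1 := by
    intro j
    ext ⟨x, z⟩ ⟨x', z'⟩
    fin_cases z
    fin_cases z'
    have := congrFun (congrFun (hY j) x') x
    simp only [Matrix.mul_apply, Matrix.conjTranspose_apply, Matrix.one_apply] at this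
    simp only [W, Matrix.mul_apply, Matrix.conjTranspose_apply, Matrix.of_apply,
      Matrix.one_apply, Fintype.sum_prod_type (α₁ := Fin 2 × Fin 2), Finset.univ_unique,
      Finset.sum_singleton, Prod.mk.injEq, and_true, mul_comm (star _), this, eq_comm]
  -- Outcome `j` has probability `2 * c j`, the trace of the `2 × 2` matrix `c j • 1`.
  refine merging_of_measurement one_pos (fun j x => u j x.1) ?_ (fun j => conjMap (W j))
    (fun j => isChannel_conjMap (hW j)) (fun j => ((2 * c j : ℝ) : ℂ)) ?_ fun j => ?_
  · rintro ⟨x, z⟩ ⟨y, z'⟩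
    fin_cases z
    fin_cases z'
    simpa using hu x y
  · rw [← Complex.ofReal_sum, ← Finset.mul_sum, hc]
    norm_num
  · have hη : ((1 : Matrix (Fin 2) (Fin 2) ℂ) ⊗ₖ W j) *ᵥ
        postMeasurement (fun x => u j x.1) (mergingInput ψ 1) =
        ((√(2 * c j) : ℝ) : ℂ) • fun q => ψ (q.1, q.2.1) := by
      ext ⟨i, q, z⟩
      have := congrFun (congrFun (hNY j) i) q
      simp only [Matrix.mul_apply, Matrix.sum_apply, Matrix.smul_apply, M, Ψ, Matrix.of_apply,
        smul_eq_mul] at this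
      simp only [Pi.smul_apply, smul_eq_mul, ← this]
      simp [mulVec, dotProduct, Fintype.sum_prod_type, W, postMeasurement, Matrix.one_apply,
        mergingInput_one_apply, mul_comm]
    rw [tensorMap_id_conjMap_pureState, hη, pureState_smul]
    congr 2
    rw [Complex.norm_real, Real.norm_eq_abs, sq_abs, Real.sq_sqrt (by
      have := (hN j).1
      positivity)]

end ZeroEntanglement

/-! ### Eigenvalues of a qubit state -/

section Eigenvalues

lemma posSemidef_reducedB {r a b : Type*} [Fintype r] [Fintype a] [Fintype b]
    (ψ : EuclideanSpace ℂ (r × a × b)) :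
    open scoped ComplexOrder in (reducedB ψ).PosSemidef := by
  open scoped ComplexOrder in
  refine posSemidef_of_expectation_nonneg fun v => ?_
  rw [expectation, star_dotProduct_reducedB_mulVec]
  exact_mod_cast Finset.sum_nonneg fun _ _ => by positivity

lemma trace_reducedB {r a b : Type*} [Fintype r] [Fintype a] [Fintype b]
    {ψ : EuclideanSpace ℂ (r × a × b)} (hψ : ‖ψ‖ = 1) : (reducedB ψ).trace = 1 := by
  have h := sum_norm_sq_eq_of_norm_eq_one hψ
  rw [← Complex.ofReal_one, ← h]
  push_cast
  simp only [Matrix.trace, Matrix.diag_apply, reducedB_apply, RCLike.star_def, Complex.mul_conj',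
    Fintype.sum_prod_type]
  rw [Finset.sum_comm]
  exact Finset.sum_congr rfl fun _ _ => Finset.sum_comm

open scoped ComplexOrder in
-- The two eigenvalues are nonnegative with sum `1`; if the larger is at most `1/2`, both equal
-- `1/2` and diagonalization gives a scalar matrix.
lemma largestEigenvalue_of_trace_eq_one {ρ : Matrix (Fin 2) (Fin 2) ℂ} (hρ : ρ.PosSemidef)
    (htr : ρ.trace = 1) {lam : ℝ} (hlam : IsLargestEigenvalue ρ lam) :
    lam ≤ 1 ∧ 1 / 2 ≤ lam ∧
      (lam ≤ 1 / 2 → ρ = (1 / 2 : ℂ) • (1 : Matrix (Fin 2) (Fin 2) ℂ)) := by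
  have hH := hρ.1
  have hsum : hH.eigenvalues 0 + hH.eigenvalues 1 = 1 := by
    have := hH.trace_eq_sum_eigenvalues
    rw [htr, Fin.sum_univ_two] at this
    apply Complex.ofReal_injective
    push_cast
    exact this.symm
  have hspec : ∀ μ : ℝ, Module.End.HasEigenvalue (Matrix.toLin' ρ) (μ : ℂ) ↔
      ∃ i, hH.eigenvalues i = μ := by
    intro μ
    rw [Module.End.hasEigenvalue_iff_mem_spectrum, Matrix.spectrum_toLin',
      ← Set.mem_range, ← hH.spectrum_real_eq_range_eigenvalues]
    exact spectrum.algebraMap_mem_iff ℂ (a := ρ) (r := μ)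
  have hle : ∀ i, hH.eigenvalues i ≤ lam := fun i => hlam.2 ((hspec _).2 ⟨i, rfl⟩)
  have hnn := hρ.eigenvalues_nonneg
  obtain ⟨i, hi⟩ := (hspec lam).1 hlam.1
  refine ⟨?_, by linarith [hle 0, hle 1], fun h => ?_⟩
  · rw [← hi]
    fin_cases i
    · exact hsum ▸ le_add_of_nonneg_right (hnn 1)
    · exact hsum ▸ le_add_of_nonneg_left (hnn 0)
  · have h0 : ∀ i, hH.eigenvalues i = 1 / 2 := by
      rw [Fin.forall_fin_two]
      constructor <;> linarith [hle 0, hle 1]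
    have hs := hH.spectral_theorem
    have hd : (Matrix.diagonal (RCLike.ofReal ∘ hH.eigenvalues) : Matrix (Fin 2) (Fin 2) ℂ) =
        (1 / 2 : ℂ) • (1 : Matrix (Fin 2) (Fin 2) ℂ) := by
      ext i j
      by_cases hij : i = j
      · subst hij; simp [h0]
      · simp [hij]
    rw [hd, map_smul, map_one] at hs
    exact hs

end Eigenvalues

end

/-! ### The main theorem -/

theorem theorem4 (ψ : EuclideanSpace ℂ (Fin 2 × Fin 2 × Fin 2)) (hψ : ‖ψ‖ = 1)
    (hR : reducedR ψ = (1 / 2 : ℂ) • (1 : Matrix (Fin 2) (Fin 2) ℂ))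
    (lam : ℝ) (hlam : IsLargestEigenvalue (reducedB ψ) lam) :
    (∀ K : ℕ, 1 ≤ K →
      (NonCatalyticExactStateMerging ψ K ↔
        Real.logb 2 (K : ℝ) ≥ Real.logb 2 ((⌈lam * 2⌉ : ℤ) : ℝ))) ∧
    ((0 : ℝ) ∈ nonCatalyticCosts ψ ↔
      reducedB ψ = (1 / 2 : ℂ) • (1 : Matrix (Fin 2) (Fin 2) ℂ)) ∧
    (reducedB ψ ≠ (1 / 2 : ℂ) • (1 : Matrix (Fin 2) (Fin 2) ℂ) →
      IsLeast (nonCatalyticCosts ψ) 1) := by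
  obtain ⟨hlam1, hlam2, hlam3⟩ :=
    largestEigenvalue_of_trace_eq_one (posSemidef_reducedB ψ) (trace_reducedB hψ) hlam
  have hconv : NonCatalyticExactStateMerging ψ 1 → lam ≤ 1 / 2 := fun h =>
    eigenvalue_le_of_merging_one hψ (by norm_num) (by push_cast; exact hR) h hlam.1
  have hone : NonCatalyticExactStateMerging ψ 1 ↔
      reducedB ψ = (1 / 2 : ℂ) • (1 : Matrix (Fin 2) (Fin 2) ℂ) :=
    ⟨fun h => hlam3 (hconv h), merging_one_of_reducedB_eq hR⟩
  have htwo : ∀ K, 2 ≤ K → NonCatalyticExactStateMerging ψ K := fun K hK => by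
    obtain ⟨n, rfl⟩ := Nat.exists_eq_add_of_le' hK
    exact merging_by_teleportation ψ n
  refine ⟨fun K hK => ?_, ⟨?_, fun h => ⟨1, le_rfl, hone.2 h, by simp⟩⟩, fun hne =>
    ⟨⟨2, by norm_num, htwo 2 le_rfl, by simp⟩, ?_⟩⟩
  -- The ceiling is `1` or `2`, so for `K ≥ 2` both sides hold and only `K = 1` carries content.
  · have hc1 : 1 ≤ ⌈lam * 2⌉ := Int.one_le_ceil_iff.2 (by linarith)
    have hc1' : (1 : ℝ) ≤ (⌈lam * 2⌉ : ℤ) := by exact_mod_cast hc1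
    have hc2 : ⌈lam * 2⌉ ≤ 2 := Int.ceil_le.2 (by push_cast; linarith)
    have hc2' : ((⌈lam * 2⌉ : ℤ) : ℝ) ≤ 2 := by exact_mod_cast hc2
    have hK' : (1 : ℝ) ≤ K := by exact_mod_cast hK
    rw [ge_iff_le, Real.logb_le_logb (by norm_num) (by linarith) (by linarith)]
    rcases hK.eq_or_lt with rfl | hK2
    · constructor
      · intro h
        exact_mod_cast Int.ceil_le.2 (by push_cast; linarith [hconv h] : lam * 2 ≤ ((1 : ℤ) : ℝ))
      · intro h
        have h' : ⌈lam * 2⌉ ≤ 1 := by exact_mod_cast h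
        have := Int.ceil_le.1 h'
        push_cast at this
        exact hone.2 (hlam3 (by linarith))
    · have : (2 : ℝ) ≤ K := by exact_mod_cast hK2
      exact iff_of_true (htwo K hK2) (hc2'.trans this)
  · rintro ⟨K, hK, hm, h0⟩
    have hK' : (1 : ℝ) ≤ K := by exact_mod_cast hK
    rcases hK.eq_or_lt with rfl | hK2
    · exact hone.1 hm
    · have : 0 < Real.logb 2 K := Real.logb_pos (by norm_num) (by exact_mod_cast hK2)
      linarith
  · rintro _ ⟨K, hK, hm, rfl⟩
    rcases hK.eq_or_lt with rfl | hK2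
    · exact absurd (hone.1 hm) hne
    · have : (2 : ℝ) ≤ K := by exact_mod_cast hK2
      rw [Real.le_logb_iff_rpow_le (by norm_num) (by linarith), Real.rpow_one]
      exact this
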